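/- **Theorem.** Let $n\ge 2$, $0\le\theta<1$. *Kernels.* A majorizing kernel with exponent $\theta\ge 0$ on $\mathbf R^n$ is a function $h:\mathbf R^n\to(0,\infty]$, finite almost everywhere, that is locally integrable and defines a tempered distribution, and for which there is $B>0$ with $$h*h(\xi)=\int_{\mathbf R^n}h(\xi-\eta)h(\eta)\,d\eta\le B|\xi|^\theta h(\xi)\qquad(\xi\in\mathbf R^n),$$ where the right-hand side is read as $\infty$ wherever $h(\xi)=\infty$. For $\alpha\ge0$, $\omega>0$ let $\mathcal H^\theta_{\alpha,\omega}(\mathbf R^n)$ be the set of majorizing kernels $h$ with exponent $\theta$ such that (1) $h(\xi)=O(|\xi|^{-\alpha})$ and $|\xi|^{-\alpha}=O(h(\xi))$ as $\xi\to0$; (2) $h(\xi)=O(|\xi|^{-\omega})$ and $|\xi|^{-\omega}=O(h(\xi))$ as $\xi\to\infty$; (3) $h$ is bounded on the complement of every neighborhood of the origin. *Spaces.* Fix $m\ge 0$. With $\hat f(\xi)=(2\pi)^{-n/2}\int e^{-ix\cdot\xi}f(x)\,dx$ (extended to tempered distributions), let $$\mathcal F_h=\Big\{f\in\mathcal S'(\mathbf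 R^n)^m:\ \hat f\in L^1_{\rm loc}(\mathbf R^n)^m,\ \|f\|_{\mathcal F_h}=\operatorname*{ess\,sup}_{\xi\in\mathbf R^n}\frac{|\hat f(\xi)|}{h(\xi)}<\infty\Big\}.$$ For $f\in\mathcal S'(\mathbf R^n)^m$ and $T>0$ let $$\|f\|_{BMO_T^{-1}}=\sup_{x\in\mathbf R^n,\ 0<R^2<T}\Big(\frac1{|B(x,R)|}\int_0^{R^2}\int_{B(x,R)}|e^{t\Delta}f(y)|^2\,dy\,dt\Big)^{1/2},$$ where $e^{t\Delta}$ is the heat semigroup, let $BMO_T^{-1}$ be the space of $f$ with $\|f\|_{BMO_T^{-1}}<\infty$, and let $\overline{VMO}{}^{-1}=\{f\in BMO_1^{-1}:\|f\|_{BMO_T^{-1}}\to0\text{ as }T\to0\}$, normed by $\|\cdot\|_{BMO_1^{-1}}$. *Claim.* Let $h\in\mathcal H^\theta_{\alpha,\omega}(\mathbf R^n)$. (a) If $0<\theta<1$, there is a constant $C$ such that for all $f\in\mathcal F_h$ and all $T>0$ $$\|f\|_{BMO_T^{-1}}\le C\,T^{(1-\theta)/2}\,\|f\|_{\mathcal F_h},$$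 and $\mathcal F_h$ is continuously embedded in $\overline{VMO}{}^{-1}$. (b) If $\theta=0$, there is a constant $C$ such that for all $f\in\mathcal F_h$ and all $T>0$ $$\|f\|_{BMO_T^{-1}}\le\begin{cases}C\,T^{1/2}\,\|f\|_{\mathcal F_h}&\text{if }\omega>n,\\ C\,T^{1/2}\,(1+\log_+T^{-1/2})^{1/2}\,\|f\|_{\mathcal F_h}&\text{if }\omega=n,\end{cases}$$ where $\log_+x=\max\{\log x,0\}$, and $\mathcal F_h$ is continuously embedded in $\overline{VMO}{}^{-1}$ (for every $\omega$ for which the hypothesis holds). -/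

import Mathlib

open MeasureTheory Filter Topology Set
open scoped ENNReal NNReal SchwartzMap FourierTransform

noncomputable section

namespace MajorizingKernels

/-- `ℝⁿ` with its Euclidean norm. -/
abbrev Rn (n : ℕ) := EuclideanSpace ℝ (Fin n)

/-! ### Tempered distributions that are functions, and the Fourier transform -/

/-- The tempered distribution `u` is the locally integrable function `g`: both agree on all smooth
compactly supported test functions. -/
def IsFunction {n : ℕ} {F : Type*} [NormedAddCommGroup F] [NormedSpace ℂ F]
    (u : 𝓢'(Rn n, F)) (g : Rn n → F) : Prop :=
  LocallyIntegrable g volume ∧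
    ∀ φ : 𝓢(Rn n, ℂ), HasCompactSupport φ → u φ = ∫ ξ, φ ξ • g ξ

/-- `f̂ ∈ L¹_loc` and `f̂ = g`, for the Fourier transform normalized as
`f̂(ξ) = (2π)^{-n/2} ∫ e^{-i x·ξ} f(x) dx`. Mathlib's transform
`𝓕 f (ζ) = ∫ e^{-2πi x·ζ} f(x) dx` equals `(2π)^{n/2} f̂(2πζ)`. -/
def HasFourierFunction {n : ℕ} {F : Type*} [NormedAddCommGroup F] [NormedSpace ℂ F]
    (f : 𝓢'(Rn n, F)) (g : Rn n → F) : Prop :=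
  IsFunction (𝓕 f)
    (fun ζ => (((2 * Real.pi) ^ ((n : ℝ) / 2) : ℝ) : ℂ) • g ((2 * Real.pi) • ζ))

/-! ### Majorizing kernels -/

/-- The convolution `h * h (ξ) = ∫ h(ξ - η) h(η) dη ∈ [0, ∞]`. -/
def selfConv {n : ℕ} (h : Rn n → ℝ≥0∞) (ξ : Rn n) : ℝ≥0∞ :=
  ∫⁻ η, h (ξ - η) * h η

/-- `h ∈ ℋ^θ(ℝⁿ)`: `h` is a majorizing kernel with exponent `θ`. -/
structure IsMajorizingKernel {n : ℕ} (θ : ℝ) (h : Rn n → ℝ≥0∞) : Prop where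
  exponent_nonneg : 0 ≤ θ
  aemeasurable : AEMeasurable h volume
  /-- `h` takes values in `(0, ∞]`. -/
  pos : ∀ ξ, 0 < h ξ
  /-- `h` is finite almost everywhere. -/
  finite_ae : volume {ξ | h ξ = ∞} = 0
  /-- `h` is a tempered distribution that is also a function. -/
  tempered : ∃ u : 𝓢'(Rn n, ℂ), IsFunction u (fun ξ => ((h ξ).toReal : ℂ))
  /-- `h * h (ξ) ≤ B |ξ|^θ h(ξ)` for all `ξ`, where the right-hand side is read as `∞` at the points
  with `h(ξ) = ∞` (also at `ξ = 0`, where Lean's `0 * ∞` would be `0`). -/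
  conv_le : ∃ B : ℝ, 0 < B ∧
    ∀ ξ, h ξ ≠ ∞ → selfConv h ξ ≤ ENNReal.ofReal (B * ‖ξ‖ ^ θ) * h ξ

/-- `h(ξ) = O(|ξ|^{-a})` and `|ξ|^{-a} = O(h(ξ))` along the filter `l`. -/
def BehavesAlong {n : ℕ} (l : Filter (Rn n)) (a : ℝ) (h : Rn n → ℝ≥0∞) : Prop :=
  (∃ C : ℝ≥0, ∀ᶠ ξ in l, h ξ ≤ C * ENNReal.ofReal (‖ξ‖ ^ (-a))) ∧
    (∃ C : ℝ≥0, ∀ᶠ ξ in l, ENNReal.ofReal (‖ξ‖ ^ (-a)) ≤ C * h ξ)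

/-- `h ∈ ℋ^θ_{α,ω}(ℝⁿ)`: a majorizing kernel with radial algebraic growth and decay. -/
structure IsRadialMajorizingKernel {n : ℕ} (θ α ω : ℝ) (h : Rn n → ℝ≥0∞) : Prop
    extends IsMajorizingKernel θ h where
  alpha_nonneg : 0 ≤ α
  omega_pos : 0 < ω
  at_origin : BehavesAlong (𝓝[≠] 0) α h
  at_infinity : BehavesAlong (Bornology.cobounded (Rn n)) ω h
  /-- `h` is bounded on the complement of any neighborhood of the origin. -/
  bounded_away : ∀ U ∈ 𝓝 (0 : Rn n), ∃ M : ℝ≥0, ∀ ξ ∉ U, h ξ ≤ M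

/-! ### The majorization space -/

/-- The norm `‖f‖_{ℱ_h} = sup_ξ |f̂(ξ)| / h(ξ)`. As `f̂` is a class of functions modulo null sets,
the supremum is the essential one. The function `f̂` is unique up to a null set if it exists, so the
infimum is over equal values; it is `∞` if `f̂` is not a locally integrable function. -/
def majNorm {n : ℕ} {F : Type*} [NormedAddCommGroup F] [NormedSpace ℂ F]
    (h : Rn n → ℝ≥0∞) (f : 𝓢'(Rn n, F)) : ℝ≥0∞ :=
  ⨅ (g : Rn n → F) (_ : HasFourierFunction f g),
    essSup (fun ξ => (h ξ)⁻¹ * ‖g ξ‖ₑ) volume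

/-- The majorization space `ℱ_h`. -/
def majSpace {n : ℕ} (F : Type*) [NormedAddCommGroup F] [NormedSpace ℂ F]
    (h : Rn n → ℝ≥0∞) : Set 𝓢'(Rn n, F) :=
  {f | ∃ g : Rn n → F, HasFourierFunction f g ∧
    essSup (fun ξ => (h ξ)⁻¹ * ‖g ξ‖ₑ) volume < ∞}

/-! ### The heat semigroup on tempered distributions -/

lemma one_add_pow_mul_exp_le {a : ℝ} (ha : 0 < a) (N : ℕ) {r : ℝ} (hr : 0 ≤ r) :
    (1 + r) ^ N * Real.exp (-a * r ^ 2) ≤ N.factorial * Real.exp (1 + 1 / (4 * a)) := by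
  have h1 : (1 + r) ^ N ≤ N.factorial * Real.exp (1 + r) := by
    have := Real.pow_div_factorial_le_exp (1 + r) (by linarith) N
    rw [div_le_iff₀ (by positivity)] at this
    linarith
  have h2 : 1 + r + -a * r ^ 2 ≤ 1 + 1 / (4 * a) := by
    have h3 : 1 / (4 * a) - (r - a * r ^ 2) = (2 * a * r - 1) ^ 2 / (4 * a) := by
      field_simp
      ring
    have h4 : 0 ≤ (2 * a * r - 1) ^ 2 / (4 * a) := by positivity
    linarith
  calc (1 + r) ^ N * Real.exp (-a * r ^ 2)
      ≤ N.factorial * Real.exp (1 + r) * Real.exp (-a * r ^ 2) := by gcongr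
    _ = N.factorial * Real.exp (1 + r + -a * r ^ 2) := by rw [mul_assoc, ← Real.exp_add]
    _ ≤ _ := by gcongr

lemma gaussian_decay {n : ℕ} {a : ℝ} (ha : 0 < a) (k m : ℕ) :
    ∃ C : ℝ, ∀ x : Rn n,
      ‖x‖ ^ k * ‖iteratedFDeriv ℝ m (fun x : Rn n => Real.exp (-a * ‖x‖ ^ 2)) x‖ ≤ C := by
  obtain ⟨l, D, hD, hq⟩ :=
    (Function.hasTemperateGrowth_norm_sq (Rn n)).norm_iteratedFDeriv_le_uniform m
  refine ⟨m.factorial * (1 + a) ^ m * (1 + D) ^ m *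
    ((k + l * m).factorial * Real.exp (1 + 1 / (4 * a))), fun x => ?_⟩
  have hg : ContDiff ℝ m (fun s : ℝ => Real.exp (-a * s)) := by fun_prop
  have hf : ContDiff ℝ m (fun x : Rn n => ‖x‖ ^ 2) := contDiff_norm_sq ℝ
  have hx : 1 ≤ 1 + ‖x‖ := by linarith [norm_nonneg x]
  have key := norm_iteratedFDeriv_comp_le (n := m) hg hf le_rfl x
    (C := (1 + a) ^ m * Real.exp (-a * ‖x‖ ^ 2)) (D := (1 + D) * (1 + ‖x‖) ^ l)
    (fun i hi => by
      rw [norm_iteratedFDeriv_eq_norm_iteratedDeriv, iteratedDeriv_exp_const_mul, norm_mul,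
        norm_pow, norm_neg, Real.norm_of_nonneg ha.le, Real.norm_of_nonneg (Real.exp_nonneg _)]
      gcongr
      calc a ^ i ≤ (1 + a) ^ i := by gcongr; linarith
        _ ≤ (1 + a) ^ m := pow_le_pow_right₀ (by linarith) hi)
    (fun i hi hi' => by
      have h1 : 1 ≤ (1 + D) * (1 + ‖x‖) ^ l :=
        one_le_mul_of_one_le_of_one_le (by linarith) (one_le_pow₀ hx)
      calc _ ≤ D * (1 + ‖x‖) ^ l := hq i hi' x
        _ ≤ (1 + D) * (1 + ‖x‖) ^ l := by gcongr; linarith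
        _ ≤ _ := le_self_pow₀ h1 (by omega))
  calc ‖x‖ ^ k * ‖iteratedFDeriv ℝ m (fun x : Rn n => Real.exp (-a * ‖x‖ ^ 2)) x‖
      ≤ (1 + ‖x‖) ^ k * (m.factorial * ((1 + a) ^ m * Real.exp (-a * ‖x‖ ^ 2)) *
          ((1 + D) * (1 + ‖x‖) ^ l) ^ m) := by
        gcongr
        · linarith
        · exact key
    _ = m.factorial * (1 + a) ^ m * (1 + D) ^ m *
          ((1 + ‖x‖) ^ (k + l * m) * Real.exp (-a * ‖x‖ ^ 2)) := by
        rw [mul_pow, ← pow_mul, pow_add]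
        ring
    _ ≤ _ := by
        exact mul_le_mul_of_nonneg_left (one_add_pow_mul_exp_le ha _ (norm_nonneg x))
          (by positivity)

/-- The Gaussian `x ↦ exp(-a |x|²)`, `a > 0`, as a Schwartz function. -/
def gaussian (n : ℕ) (a : ℝ) (ha : 0 < a) : 𝓢(Rn n, ℝ) where
  toFun x := Real.exp (-a * ‖x‖ ^ 2)
  smooth' := Real.contDiff_exp.comp (contDiff_const.mul (contDiff_norm_sq ℝ))
  decay' := gaussian_decay ha

/-- The heat kernel `x ↦ (4πt)^{-n/2} exp(-|x|²/(4t))`, `t > 0`, as a Schwartz function. -/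
def heatKernel (n : ℕ) (t : ℝ) (ht : 0 < t) : 𝓢(Rn n, ℂ) :=
  (((4 * Real.pi * t) ^ (-(n : ℝ) / 2) : ℝ) : ℂ) •
    (gaussian n (1 / (4 * t)) (by positivity)).postcompCLM Complex.ofRealCLM

lemma heatKernel_apply (n : ℕ) (t : ℝ) (ht : 0 < t) (x : Rn n) :
    heatKernel n t ht x =
      (((4 * Real.pi * t) ^ (-(n : ℝ) / 2) * Real.exp (-‖x‖ ^ 2 / (4 * t)) : ℝ) : ℂ) := by
  have : heatKernel n t ht x = (((4 * Real.pi * t) ^ (-(n : ℝ) / 2) : ℝ) : ℂ) *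
      ((Real.exp (-(1 / (4 * t)) * ‖x‖ ^ 2) : ℝ) : ℂ) := rfl
  rw [this, ← Complex.ofReal_mul]
  congr 3
  ring

/-- The heat semigroup: `(e^{tΔ} f)(y)` for `t > 0`, i.e. the distribution `f` applied to
`z ↦ heatKernel t (z - y)` (the heat kernel is even). The value for `t ≤ 0` is never used. -/
def heat {n : ℕ} {F : Type*} [NormedAddCommGroup F] [NormedSpace ℂ F]
    (t : ℝ) (f : 𝓢'(Rn n, F)) (y : Rn n) : F :=
  if ht : 0 < t then f (SchwartzMap.compSubConstCLM ℂ y (heatKernel n t ht)) else 0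

/-! ### The spaces `BMO_T^{-1}` and `VMO-bar^{-1}` -/

/-- `‖f‖_{BMO_T^{-1}}`, the supremum over all `x` and all `0 < R` with `R² < T` of
`(|B(x,R)|⁻¹ ∫_0^{R²} ∫_{B(x,R)} |e^{tΔ} f(y)|² dy dt)^{1/2}`. -/
def bmoNorm {n : ℕ} {F : Type*} [NormedAddCommGroup F] [NormedSpace ℂ F]
    (T : ℝ) (f : 𝓢'(Rn n, F)) : ℝ≥0∞ :=
  ⨆ (x : Rn n) (R : ℝ) (_ : 0 < R) (_ : R ^ 2 < T),
    ((volume (Metric.ball x R))⁻¹ *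
      ∫⁻ t in Ioo 0 (R ^ 2), ∫⁻ y in Metric.ball x R, ‖heat t f y‖ₑ ^ 2) ^ (1 / 2 : ℝ)

/-- `VMO-bar^{-1}`: the `f ∈ BMO_1^{-1}` with `‖f‖_{BMO_T^{-1}} → 0` as `T → 0`. Its norm is that of
`BMO_1^{-1}`. -/
def vmoSpace (n : ℕ) (F : Type*) [NormedAddCommGroup F] [NormedSpace ℂ F] :
    Set 𝓢'(Rn n, F) :=
  {f | bmoNorm 1 f < ∞ ∧ Tendsto (fun T : ℝ => bmoNorm T f) (𝓝[>] 0) (𝓝 0)}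

/-- The continuous embedding `X ↪ Y` of two normed spaces of tempered distributions: `X ⊆ Y`, and
the (linear) inclusion is bounded. -/
def ContinuouslyEmbeds {V : Type*} (X : Set V) (normX : V → ℝ≥0∞)
    (Y : Set V) (normY : V → ℝ≥0∞) : Prop :=
  X ⊆ Y ∧ ∃ C : ℝ≥0, ∀ f ∈ X, normY f ≤ C * normX f

end MajorizingKernels

end

open MajorizingKernels

/-!
On the Fourier side `e^{tΔ}` is a contraction, so `|(e^{tΔ} f)^| ≤ |f̂| ≤ M h` with
`M = ‖f‖_{𝓕_h}`. Integrating `|e^{tΔ} f|²` over a ball `B(x, R)` against a Gaussian weight, which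
dominates the indicator of the ball and whose transform is again a positive Gaussian, bounds the
mean square by a multiple of `M²` times the quadratic form
`Q(R) = ∬ h(ξ) h(η) exp(-R²|ξ-η|²/(4π)) dξ dη`, uniformly in `x` and `t`. Thus
`‖f‖²_{BMO⁻¹_T}` is at most a constant times `M² sup_{R² < T} R² Q(R)`.

Since `h(-η) ≲ h(η)`, replacing `η` by `-η` turns `Q(R)` into
`∫ (h * h)(ζ) exp(-R²|ζ|²/(4π)) dζ`, and the convolution inequality leaves
`∫ |ζ|^θ h(ζ) exp(-R²|ζ|²/(4π)) dζ`. Testing the convolution inequality on balls away from the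
origin gives `α ≤ n - θ ≤ ω`, hence `h(ζ) ≲ |ζ|^{θ-n}`. For `θ > 0` scaling then yields
`Q(R) ≲ R^{-2θ}`. For `θ = 0` the integral stays bounded when `ω > n`, and grows like
`1 + log₊(1/R)` when `ω = n`.
-/

noncomputable section

namespace MajorizingKernels

section CompactlySupportedApproximation

open scoped ContDiff

variable {E F : Type*} [NormedAddCommGroup E] [NormedSpace ℝ E] [NormedAddCommGroup F]
  [NormedSpace ℝ F]

/-- Where `e (a • x) ≠ 0` one has `1 ≤ a ‖x‖ / r`, so one more power of `‖x‖` buys `a / r`. -/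
lemma norm_pow_mul_norm_iteratedFDeriv_comp_smul_smul_le {e : E → ℝ} (he : ContDiff ℝ ∞ e)
    {D : ℕ → ℝ} (hD : ∀ i x, ‖iteratedFDeriv ℝ i e x‖ ≤ D i) {r : ℝ} (hr : 0 < r)
    (her : ∀ x, ‖x‖ < r → e x = 0) (ψ : 𝓢(E, F)) (k m : ℕ) {a : ℝ} (ha : 0 < a) (ha1 : a ≤ 1)
    (x : E) :
    ‖x‖ ^ k * ‖iteratedFDeriv ℝ m (fun y => e (a • y) • ψ y) x‖ ≤
      a / r * ∑ i ∈ Finset.range (m + 1),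
        (m.choose i : ℝ) * D i * SchwartzMap.seminorm ℝ (k + 1) (m - i) ψ := by
  have hD0 : ∀ i, 0 ≤ D i := fun i => (norm_nonneg _).trans (hD i 0)
  rcases lt_or_ge (a * ‖x‖) r with hx | hx
  · have hzero : (fun y => e (a • y) • ψ y) =ᶠ[𝓝 x] fun _ => 0 := by
      have hnear : ∀ᶠ y in 𝓝 x, a * ‖y‖ < r :=
        (continuous_const.mul continuous_norm).continuousAt.eventually_lt continuousAt_const hx
      filter_upwards [hnear] with y hy
      rw [her _ (by rwa [norm_smul, Real.norm_of_nonneg ha.le]), zero_smul]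
    rw [(hzero.iteratedFDeriv ℝ m).eq_of_nhds, iteratedFDeriv_fun_zero, Pi.zero_apply, norm_zero,
      mul_zero]
    exact mul_nonneg (by positivity) (Finset.sum_nonneg fun i _ =>
      mul_nonneg (mul_nonneg (by positivity) (hD0 i)) (apply_nonneg _ _))
  · have hleibniz := norm_iteratedFDeriv_smul_le (he.comp (contDiff_const_smul a)) (ψ.smooth ⊤) x
      (n := m) (by exact_mod_cast le_top)
    have hpow : ‖x‖ ^ k ≤ a / r * ‖x‖ ^ (k + 1) := by
      rw [div_mul_eq_mul_div, le_div_iff₀ hr, pow_succ]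
      nlinarith [pow_nonneg (norm_nonneg x) k]
    calc _ ≤ (a / r * ‖x‖ ^ (k + 1)) * _ :=
          mul_le_mul hpow hleibniz (norm_nonneg _) (by positivity)
      _ = a / r * ∑ i ∈ Finset.range (m + 1),
          (m.choose i : ℝ) * ‖iteratedFDeriv ℝ i (e ∘ fun y : E => a • y) x‖ *
            (‖x‖ ^ (k + 1) * ‖iteratedFDeriv ℝ (m - i) ψ x‖) := by
        rw [mul_assoc, Finset.mul_sum]
        congr 1
        exact Finset.sum_congr rfl fun i _ => by ring
      _ ≤ _ := by
        gcongr with i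
        · exact mul_nonneg (by positivity) (hD0 i)
        · rw [Function.comp_def, iteratedFDeriv_comp_const_smul a
            (he.of_le (by exact_mod_cast le_top)), norm_smul, norm_pow, Real.norm_of_nonneg ha.le]
          exact (mul_le_of_le_one_left (norm_nonneg _) (pow_le_one₀ ha.le ha1)).trans (hD _ _)
        · exact SchwartzMap.le_seminorm ℝ _ _ ψ x

lemma tendsto_smulLeftCLM_comp_smul_zero {e : E → ℝ} (he : e.HasTemperateGrowth)
    (hD : ∀ i, ∃ D, ∀ x, ‖iteratedFDeriv ℝ i e x‖ ≤ D) {r : ℝ} (hr : 0 < r)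
    (her : ∀ x, ‖x‖ < r → e x = 0) (ψ : 𝓢(E, F)) :
    Tendsto (fun a : ℝ => SchwartzMap.smulLeftCLM F (fun x => e (a • x)) ψ) (𝓝[>] 0) (𝓝 0) := by
  choose D hD using hD
  rw [(schwartz_withSeminorms ℝ E F).tendsto_nhds]
  rintro ⟨k, m⟩ ε hε
  set S := ∑ i ∈ Finset.range (m + 1),
    (m.choose i : ℝ) * D i * SchwartzMap.seminorm ℝ (k + 1) (m - i) ψ
  have hlim : Tendsto (fun a : ℝ => a / r * S) (𝓝[>] 0) (𝓝 0) := by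
    have : Tendsto (fun a : ℝ => a / r * S) (𝓝 0) (𝓝 (0 / r * S)) :=
      (continuous_id.div_const r |>.mul_const S).tendsto 0
    simpa using this.mono_left nhdsWithin_le_nhds
  filter_upwards [hlim.eventually (gt_mem_nhds hε), self_mem_nhdsWithin,
    mem_nhdsWithin_of_mem_nhds (Iic_mem_nhds one_pos)] with a haε ha0 ha1
  have hbound := norm_pow_mul_norm_iteratedFDeriv_comp_smul_smul_le he.1 hD hr her ψ k m ha0 ha1
  refine lt_of_le_of_lt ?_ haε
  rw [sub_zero]
  refine SchwartzMap.seminorm_le_bound ℝ k m _ (le_trans (by positivity) (hbound 0)) fun x => ?_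
  rw [SchwartzMap.smulLeftCLM_apply (by fun_prop)]
  exact hbound x

variable [FiniteDimensional ℝ E]

lemma exists_norm_iteratedFDeriv_one_sub_contDiffBump_le (χ : ContDiffBump (0 : E)) (i : ℕ) :
    ∃ D, ∀ x, ‖iteratedFDeriv ℝ i (fun y => 1 - χ y) x‖ ≤ D := by
  have hcont : Continuous (iteratedFDeriv ℝ i χ) :=
    χ.contDiff.continuous_iteratedFDeriv (n := i) le_rfl
  obtain ⟨D, hD⟩ := hcont.bounded_above_of_compact_support (χ.hasCompactSupport.iteratedFDeriv i)
  refine ⟨1 + D, fun x => ?_⟩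
  rw [fun_iteratedFDeriv_sub_apply contDiff_const.contDiffAt χ.contDiff.contDiffAt]
  refine (norm_sub_le _ _).trans (add_le_add ?_ (hD x))
  rcases eq_or_ne i 0 with rfl | hi
  · simp
  · simp [iteratedFDeriv_const_of_ne hi]

lemma tendsto_smulLeftCLM_contDiffBump (χ : ContDiffBump (0 : E)) (ψ : 𝓢(E, F)) :
    Tendsto (fun a : ℝ => SchwartzMap.smulLeftCLM F (fun x => χ (a • x)) ψ) (𝓝[>] 0) (𝓝 ψ) := by
  have hχ : (χ : E → ℝ).HasTemperateGrowth := χ.hasCompactSupport.hasTemperateGrowth χ.contDiff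
  have he := tendsto_smulLeftCLM_comp_smul_zero (e := fun x => 1 - χ x) (by fun_prop)
    (exists_norm_iteratedFDeriv_one_sub_contDiffBump_le χ) χ.rIn_pos
    (fun x hx => by rw [χ.one_of_mem_closedBall (by simpa using hx.le), sub_self]) ψ
  have hsub : Tendsto (fun a : ℝ => ψ - SchwartzMap.smulLeftCLM F (fun x => 1 - χ (a • x)) ψ)
      (𝓝[>] 0) (𝓝 ψ) := by
    simpa using he.const_sub ψ
  refine hsub.congr fun a => ?_
  ext x
  have hχa : (fun x => χ (a • x)).HasTemperateGrowth := by fun_prop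
  rw [sub_apply, SchwartzMap.smulLeftCLM_apply_apply hχa,
    SchwartzMap.smulLeftCLM_apply_apply (by fun_prop)]
  module

end CompactlySupportedApproximation

/-! ### The heat semigroup on the Fourier side -/

lemma integrable_schwartz_smul {E F : Type*} [NormedAddCommGroup E] [NormedSpace ℝ E]
    [FiniteDimensional ℝ E] [MeasurableSpace E] [BorelSpace E] {μ : Measure E}
    [μ.HasTemperateGrowth] [NormedAddCommGroup F] [NormedSpace ℂ F] {G : E → F}
    (hG : LocallyIntegrable G μ) {r K : ℝ} (hK : ∀ᵐ ζ ∂μ, r ≤ ‖ζ‖ → ‖G ζ‖ ≤ K) (ψ : 𝓢(E, ℂ)) :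
    Integrable (fun ζ => ψ ζ • G ζ) μ := by
  have hproper : ProperSpace E := FiniteDimensional.proper ℝ E
  have hin : IntegrableOn (fun ζ => ψ ζ • G ζ) (Metric.closedBall 0 r) μ :=
    Integrable.bdd_smul (hG.integrableOn_isCompact (isCompact_closedBall 0 r)) _
      ψ.continuous.aestronglyMeasurable (ae_of_all _ (SchwartzMap.norm_le_seminorm ℂ ψ))
  have hout : IntegrableOn (fun ζ => ψ ζ • G ζ) (Metric.closedBall 0 r)ᶜ μ := by
    refine Integrable.mono' ((ψ.integrable (μ := μ)).norm.mul_const K).integrableOn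
      (ψ.continuous.aestronglyMeasurable.smul hG.aestronglyMeasurable).restrict ?_
    rw [ae_restrict_iff' Metric.isClosed_closedBall.measurableSet.compl]
    filter_upwards [hK] with ζ hζ hr
    rw [norm_smul]
    exact mul_le_mul_of_nonneg_left (hζ (by simpa using (not_le.mp (by simpa using hr)).le))
      (norm_nonneg _)
  simpa using hin.union hout

/-- `IsFunction` only tests compactly supported Schwartz functions; the cut-offs `χ (a • x) ψ x` of
an arbitrary `ψ` converge to it as `a → 0`. -/
lemma IsFunction.apply_eq_integral {n : ℕ} {F : Type*} [NormedAddCommGroup F] [NormedSpace ℂ F]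
    {u : 𝓢'(Rn n, F)} {G : Rn n → F} (hu : IsFunction u G) {r K : ℝ}
    (hK : ∀ᵐ ζ, r ≤ ‖ζ‖ → ‖G ζ‖ ≤ K) (ψ : 𝓢(Rn n, ℂ)) : u ψ = ∫ ζ, ψ ζ • G ζ := by
  let χ : ContDiffBump (0 : Rn n) := default
  let Ψ : ℝ → 𝓢(Rn n, ℂ) := fun a => SchwartzMap.smulLeftCLM ℂ (fun x => χ (a • x)) ψ
  have hχ : (χ : Rn n → ℝ).HasTemperateGrowth := χ.hasCompactSupport.hasTemperateGrowth χ.contDiff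
  have hΨ : ∀ a, ⇑(Ψ a) = fun x => χ (a • x) • ψ x := fun a =>
    SchwartzMap.smulLeftCLM_apply (by fun_prop) ψ
  have hlim : Tendsto (fun a => u (Ψ a)) (𝓝[>] 0) (𝓝 (u ψ)) :=
    ((map_continuous u).tendsto ψ).comp (tendsto_smulLeftCLM_contDiffBump χ ψ)
  have hlim' : Tendsto (fun a => ∫ ζ, Ψ a ζ • G ζ) (𝓝[>] 0) (𝓝 (∫ ζ, ψ ζ • G ζ)) := by
    refine tendsto_integral_filter_of_dominated_convergence (fun ζ => ‖ψ ζ • G ζ‖)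
      (.of_forall fun a => (Ψ a).continuous.aestronglyMeasurable.smul hu.1.aestronglyMeasurable)
      (.of_forall fun a => ae_of_all _ fun ζ => ?_) (integrable_schwartz_smul hu.1 hK ψ).norm
      (ae_of_all _ fun ζ => ?_)
    · rw [hΨ, smul_assoc, norm_smul, Real.norm_of_nonneg χ.nonneg]
      exact mul_le_of_le_one_left (norm_nonneg _) χ.le_one
    · have hχ1 : Tendsto (fun a : ℝ => χ (a • ζ)) (𝓝[>] 0) (𝓝 1) := by
        rw [← χ.one_of_mem_closedBall (x := (0 : ℝ) • ζ) (by simp [χ.rIn_pos.le])]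
        exact ((χ.continuous.comp (continuous_id.smul continuous_const)).tendsto 0).mono_left
          nhdsWithin_le_nhds
      simpa [hΨ] using (hχ1.smul_const (ψ ζ)).smul_const (G ζ)
  refine tendsto_nhds_unique hlim (hlim'.congr' ?_)
  filter_upwards [self_mem_nhdsWithin] with a ha
  have hcs : HasCompactSupport (Ψ a) := by
    rw [hΨ]
    exact (χ.hasCompactSupport.comp_smul (ne_of_gt ha)).smul_right
  exact (hu.2 _ hcs).symm

lemma fourierInv_compSubConstCLM {V : Type*} [NormedAddCommGroup V] [InnerProductSpace ℝ V]
    [FiniteDimensional ℝ V] [MeasurableSpace V] [BorelSpace V] (φ : 𝓢(V, ℂ)) (y ζ : V) :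
    𝓕⁻ (SchwartzMap.compSubConstCLM ℂ y φ) ζ = Real.fourierChar (inner ℝ ζ y) • 𝓕⁻ φ ζ := by
  rw [SchwartzMap.fourierInv_coe, SchwartzMap.fourierInv_coe, Real.fourierInv_eq,
    Real.fourierInv_eq, ← integral_add_right_eq_self _ y, Circle.smul_def, ← integral_smul]
  congr 1 with v
  rw [SchwartzMap.compSubConstCLM_apply, add_sub_cancel_right, inner_add_left,
    AddChar.map_add_eq_mul, mul_comm, mul_smul, real_inner_comm y, ← Circle.smul_def]

lemma fourierInv_heatKernel {n : ℕ} {t : ℝ} (ht : 0 < t) (ζ : Rn n) :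
    𝓕⁻ (heatKernel n t ht) ζ = (Real.exp (-(4 * Real.pi ^ 2 * t) * ‖ζ‖ ^ 2) : ℝ) := by
  have hpi : (0 : ℝ) < 4 * Real.pi * t := by positivity
  have hkernel : (heatKernel n t ht : Rn n → ℂ) =
      (((4 * Real.pi * t) ^ (-(n : ℝ) / 2) : ℝ) : ℂ) •
        fun x => Complex.exp (-((1 / (4 * t) : ℝ) : ℂ) * (‖x‖ : ℂ) ^ 2) := by
    ext x
    rw [heatKernel_apply, Pi.smul_apply, smul_eq_mul]
    push_cast
    congr 2
    ring
  have hconst : ((Real.pi : ℂ) / ((1 / (4 * t) : ℝ) : ℂ)) ^ ((n : ℂ) / 2) =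
      (((4 * Real.pi * t) ^ ((n : ℝ) / 2) : ℝ) : ℂ) := by
    rw [Complex.ofReal_cpow hpi.le]
    congr 1
    · push_cast; field_simp
    · push_cast; rfl
  have hre : 0 < ((1 / (4 * t) : ℝ) : ℂ).re := by rw [Complex.ofReal_re]; positivity
  have hsmul := congrFun (VectorFourier.fourierIntegral_const_smul Real.fourierChar volume
    (innerₗ (Rn n)) (fun x => Complex.exp (-((1 / (4 * t) : ℝ) : ℂ) * (‖x‖ : ℂ) ^ 2))
    (((4 * Real.pi * t) ^ (-(n : ℝ) / 2) : ℝ) : ℂ)) (-ζ)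
  rw [SchwartzMap.fourierInv_coe, hkernel, Real.fourierInv_eq_fourier_neg]
  refine hsmul.trans ?_
  rw [Pi.smul_apply]
  refine (congrArg _ (fourier_gaussian_innerProductSpace hre (-ζ))).trans ?_
  rw [finrank_euclideanSpace, Fintype.card_fin, hconst, smul_eq_mul, ← mul_assoc,
    ← Complex.ofReal_mul, ← Real.rpow_add hpi, neg_div, neg_add_cancel, Real.rpow_zero,
    Complex.ofReal_one, one_mul, norm_neg, Complex.ofReal_exp]
  congr 1
  push_cast
  field_simp

lemma heat_eq_fourierInv {n : ℕ} {F : Type*} [NormedAddCommGroup F] [NormedSpace ℂ F]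
    {f : 𝓢'(Rn n, F)} {G : Rn n → F} (hf : IsFunction (𝓕 f) G) {r K : ℝ}
    (hK : ∀ᵐ ζ, r ≤ ‖ζ‖ → ‖G ζ‖ ≤ K) {t : ℝ} (ht : 0 < t) (y : Rn n) :
    heat t f y =
      𝓕⁻ (fun ζ => ((Real.exp (-(4 * Real.pi ^ 2 * t) * ‖ζ‖ ^ 2) : ℝ) : ℂ) • G ζ) y := by
  have hinv : 𝓕 (𝓕⁻ (SchwartzMap.compSubConstCLM ℂ y (heatKernel n t ht)) : 𝓢(Rn n, ℂ)) =
      SchwartzMap.compSubConstCLM ℂ y (heatKernel n t ht) :=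
    FourierTransform.fourier_fourierInv_eq _
  rw [heat, dif_pos ht, ← hinv, ← TemperedDistribution.fourier_apply, hf.apply_eq_integral hK,
    Real.fourierInv_eq]
  congr 1 with ζ
  rw [fourierInv_compSubConstCLM, fourierInv_heatKernel, smul_assoc]

section GaussianWeight

variable {V E F : Type*} [NormedAddCommGroup V] [InnerProductSpace ℝ V] [FiniteDimensional ℝ V]
  [MeasurableSpace V] [BorelSpace V] [NormedAddCommGroup E] [NormedSpace ℂ E]
  [NormedAddCommGroup F] [InnerProductSpace ℂ F] [CompleteSpace F]

lemma continuous_fourierInv {v : V → E} (hv : Integrable v) : Continuous (𝓕⁻ v) :=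
  VectorFourier.fourierIntegral_continuous (L := -innerₗ V) Real.continuous_fourierChar
    (continuous_inner.neg) hv

lemma norm_fourierInv_le (v : V → E) (y : V) : ‖𝓕⁻ v y‖ ≤ ∫ ζ, ‖v ζ‖ :=
  VectorFourier.norm_fourierIntegral_le_integral_norm Real.fourierChar volume (-innerₗ V) v y

lemma flip_neg_innerₗ {W : Type*} [NormedAddCommGroup W] [InnerProductSpace ℝ W] :
    (-innerₗ W).flip = -innerₗ W := by
  ext x y
  simp [real_inner_comm]

lemma fourier_smul_fourierInv [CompleteSpace E] {w : V → ℂ} {v : V → E} (hw : Integrable w)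
    (hv : Integrable v) (ζ : V) : 𝓕 (fun y => w y • 𝓕⁻ v y) ζ = ∫ η, 𝓕 w (ζ - η) • v η := by
  have hmod : Integrable (fun y => Real.fourierChar (-inner ℝ y ζ) • w y) :=
    (Real.fourierIntegral_convergent_iff ζ).2 hw
  have hflip := VectorFourier.integral_fourierIntegral_smul_eq_flip (L := -innerₗ V)
    Real.continuous_fourierChar continuous_inner.neg hmod hv
  have hleft : ∀ η, VectorFourier.fourierIntegral Real.fourierChar volume (-innerₗ V)
      (fun y => Real.fourierChar (-inner ℝ y ζ) • w y) η = 𝓕 w (ζ - η) := fun η => by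
    rw [Real.fourier_eq, VectorFourier.fourierIntegral]
    congr 1 with y
    rw [smul_smul, ← AddChar.map_add_eq_mul, inner_sub_right]
    congr 2
    simp only [LinearMap.neg_apply, innerₗ_apply_apply]
    ring
  simp only [hleft] at hflip
  rw [hflip, Real.fourier_eq]
  congr 1 with y
  rw [smul_assoc]
  congr 2
  exact congrArg (fun L => VectorFourier.fourierIntegral Real.fourierChar volume L v y)
    flip_neg_innerₗ.symm

lemma integral_ofReal_mul_norm_sq_fourierInv {g : V → ℝ} {v : V → F} (hg : Integrable g)
    (hv : Integrable v) :
    ∫ y, ((g y * ‖𝓕⁻ v y‖ ^ 2 : ℝ) : ℂ) =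
      ∫ ζ, inner ℂ (v ζ) (∫ η, 𝓕 (fun y => (g y : ℂ)) (ζ - η) • v η) := by
  have hgc : Integrable (fun y => (g y : ℂ)) := hg.ofReal
  have hgv : Integrable (fun y => (g y : ℂ) • 𝓕⁻ v y) :=
    hgc.smul_bdd _ (continuous_fourierInv hv).aestronglyMeasurable
      (ae_of_all _ (norm_fourierInv_le v))
  have hsesq := VectorFourier.integral_sesq_fourierIntegral_eq_neg_flip (innerSL ℂ)
    (L := -innerₗ V) Real.continuous_fourierChar continuous_inner.neg hv hgv
  calc ∫ y, ((g y * ‖𝓕⁻ v y‖ ^ 2 : ℝ) : ℂ)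
      = ∫ y, inner ℂ (𝓕⁻ v y) ((g y : ℂ) • 𝓕⁻ v y) := by
        congr 1 with y
        rw [inner_smul_right, inner_self_eq_norm_sq_to_K]
        push_cast
        rfl
    _ = ∫ ζ, inner ℂ (v ζ) (𝓕 (fun y => (g y : ℂ) • 𝓕⁻ v y) ζ) := by
        have hL : -(-innerₗ V).flip = innerₗ V := by rw [flip_neg_innerₗ]; ext x y; simp
        rw [hL] at hsesq
        exact hsesq
    _ = _ := by simp only [fourier_smul_fourierInv hgc hv]

lemma lintegral_ofReal_mul_enorm_sq_fourierInv_le {g : V → ℝ} {v : V → F} (hg : Integrable g)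
    (hg0 : 0 ≤ g) (hv : Integrable v) :
    ∫⁻ y, ENNReal.ofReal (g y) * ‖𝓕⁻ v y‖ₑ ^ 2 ≤
      ∫⁻ ζ, ∫⁻ η, ‖v ζ‖ₑ * ‖v η‖ₑ * ‖𝓕 (fun y => (g y : ℂ)) (ζ - η)‖ₑ := by
  have hint : Integrable (fun y => g y * ‖𝓕⁻ v y‖ ^ 2) :=
    hg.mul_bdd (c := (∫ ζ, ‖v ζ‖) ^ 2) ((continuous_fourierInv hv).norm.pow 2).aestronglyMeasurable
      (ae_of_all _ fun y => by
        rw [norm_pow, norm_norm]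
        exact pow_le_pow_left₀ (norm_nonneg _) (norm_fourierInv_le v y) 2)
  calc ∫⁻ y, ENNReal.ofReal (g y) * ‖𝓕⁻ v y‖ₑ ^ 2
      = ‖∫ y, ((g y * ‖𝓕⁻ v y‖ ^ 2 : ℝ) : ℂ)‖ₑ := by
        rw [integral_complex_ofReal, ← ofReal_norm, Complex.norm_real, Real.norm_of_nonneg
          (integral_nonneg fun y => mul_nonneg (hg0 y) (sq_nonneg _)),
          ofReal_integral_eq_lintegral_ofReal hint
            (ae_of_all _ fun y => mul_nonneg (hg0 y) (sq_nonneg _))]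
        refine lintegral_congr fun y => ?_
        rw [ENNReal.ofReal_mul (hg0 y), ENNReal.ofReal_pow (norm_nonneg _), ofReal_norm]
    _ ≤ ∫⁻ ζ, ‖v ζ‖ₑ * ∫⁻ η, ‖𝓕 (fun y => (g y : ℂ)) (ζ - η) • v η‖ₑ := by
        rw [integral_ofReal_mul_norm_sq_fourierInv hg hv]
        refine (enorm_integral_le_lintegral_enorm _).trans (lintegral_mono fun ζ => ?_)
        calc _ ≤ ‖v ζ‖ₑ * ‖∫ η, 𝓕 (fun y => (g y : ℂ)) (ζ - η) • v η‖ₑ :=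
              ENNReal.coe_le_coe.mpr (nnnorm_inner_le_nnnorm (v ζ) _)
          _ ≤ _ := by gcongr; exact enorm_integral_le_lintegral_enorm _
    _ = _ := by
        refine lintegral_congr fun ζ => ?_
        rw [← lintegral_const_mul' _ _ enorm_ne_top]
        refine lintegral_congr fun η => ?_
        rw [enorm_smul]
        ring

lemma enorm_fourier_gaussian {R : ℝ} (hR : 0 < R) (x ζ : V) :
    ‖𝓕 (fun y => (Real.exp (-(Real.pi / R ^ 2) * ‖y - x‖ ^ 2) : ℂ)) ζ‖ₑ =
      ENNReal.ofReal (R ^ Module.finrank ℝ V * Real.exp (-Real.pi * R ^ 2 * ‖ζ‖ ^ 2)) := by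
  have hre : 0 < ((Real.pi / R ^ 2 : ℝ) : ℂ).re := by rw [Complex.ofReal_re]; positivity
  have hgauss := fourier_gaussian_innerProductSpace hre ζ
  have hconst : ((Real.pi : ℂ) / ((Real.pi / R ^ 2 : ℝ) : ℂ)) ^ (Module.finrank ℝ V / 2 : ℂ) =
      ((R ^ Module.finrank ℝ V : ℝ) : ℂ) := by
    have hhalf : (Module.finrank ℝ V / 2 : ℂ) = ((Module.finrank ℝ V / 2 : ℝ) : ℂ) := by
      push_cast; rfl
    rw [← Complex.ofReal_div, div_div_cancel₀ Real.pi_ne_zero, hhalf,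
      ← Complex.ofReal_cpow (by positivity), ← Real.rpow_natCast_mul hR.le, Nat.cast_ofNat,
      mul_div_cancel₀ _ two_ne_zero, Real.rpow_natCast]
  have hexp : -(Real.pi : ℂ) ^ 2 * (‖ζ‖ : ℂ) ^ 2 / ((Real.pi / R ^ 2 : ℝ) : ℂ) =
      ((-Real.pi * R ^ 2 * ‖ζ‖ ^ 2 : ℝ) : ℂ) := by
    push_cast
    field_simp
  rw [hconst, hexp, ← Complex.ofReal_exp, ← Complex.ofReal_mul] at hgauss
  have htranslate := congrFun (VectorFourier.fourierIntegral_comp_add_right Real.fourierChar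
    volume (innerₗ V) (fun y => (Real.exp (-(Real.pi / R ^ 2) * ‖y‖ ^ 2) : ℂ)) (-x)) ζ
  have hshift : 𝓕 (fun y => (Real.exp (-(Real.pi / R ^ 2) * ‖y - x‖ ^ 2) : ℂ)) ζ =
      Real.fourierChar (inner ℝ (-x) ζ) •
        𝓕 ((fun y => Complex.exp (-((Real.pi / R ^ 2 : ℝ) : ℂ) * (‖y‖ : ℂ) ^ 2)) : V → ℂ) ζ := by
    simp only [sub_eq_add_neg]
    refine htranslate.trans ?_
    push_cast
    rfl
  rw [hshift, hgauss, ← ofReal_norm, Circle.norm_smul, Complex.norm_real,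
    Real.norm_of_nonneg (by positivity)]

lemma lintegral_ball_enorm_sq_fourierInv_le {v : V → F} (hv : Integrable v) (x : V) {R : ℝ}
    (hR : 0 < R) :
    ∫⁻ y in Metric.ball x R, ‖𝓕⁻ v y‖ₑ ^ 2 ≤
      ENNReal.ofReal (Real.exp Real.pi * R ^ Module.finrank ℝ V) *
        ∫⁻ ζ, ∫⁻ η, ‖v ζ‖ₑ * ‖v η‖ₑ *
          ENNReal.ofReal (Real.exp (-Real.pi * R ^ 2 * ‖ζ - η‖ ^ 2)) := by
  let g : V → ℝ := fun y => Real.exp (-(Real.pi / R ^ 2) * ‖y - x‖ ^ 2)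
  have hg : Integrable g := by
    have hb : 0 < ((Real.pi / R ^ 2 : ℝ) : ℂ).re := by rw [Complex.ofReal_re]; positivity
    refine (((GaussianFourier.integrable_cexp_neg_mul_sq_norm_add hb 0 (0 : V)).norm).comp_sub_right
      x).congr (ae_of_all _ fun y => ?_)
    simp only [zero_mul, add_zero, g, Complex.norm_exp]
    norm_cast
  have hone : ∀ y ∈ Metric.ball x R, 1 ≤ Real.exp Real.pi * g y := fun y hy => by
    rw [← Real.exp_add, Real.one_le_exp_iff]
    have hy' : ‖y - x‖ ^ 2 ≤ R ^ 2 := by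
      gcongr
      exact (mem_ball_iff_norm.mp hy).le
    have : Real.pi / R ^ 2 * ‖y - x‖ ^ 2 ≤ Real.pi / R ^ 2 * R ^ 2 := by gcongr
    rw [div_mul_cancel₀ _ (by positivity)] at this
    linarith
  calc ∫⁻ y in Metric.ball x R, ‖𝓕⁻ v y‖ₑ ^ 2
      ≤ ∫⁻ y in Metric.ball x R, ENNReal.ofReal (Real.exp Real.pi) *
          (ENNReal.ofReal (g y) * ‖𝓕⁻ v y‖ₑ ^ 2) := by
        refine setLIntegral_mono' measurableSet_ball fun y hy => ?_
        rw [← mul_assoc, ← ENNReal.ofReal_mul (by positivity)]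
        exact le_mul_of_one_le_left zero_le (ENNReal.one_le_ofReal.mpr (hone y hy))
    _ ≤ ENNReal.ofReal (Real.exp Real.pi) * ∫⁻ y, ENNReal.ofReal (g y) * ‖𝓕⁻ v y‖ₑ ^ 2 := by
        rw [← lintegral_const_mul' _ _ ENNReal.ofReal_ne_top]
        exact setLIntegral_le_lintegral _ _
    _ ≤ ENNReal.ofReal (Real.exp Real.pi) *
          ∫⁻ ζ, ∫⁻ η, ‖v ζ‖ₑ * ‖v η‖ₑ * ‖𝓕 (fun y => (g y : ℂ)) (ζ - η)‖ₑ := by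
        exact mul_le_mul_right (lintegral_ofReal_mul_enorm_sq_fourierInv_le hg
          (fun y => (Real.exp_pos _).le) hv) _
    _ = _ := by
        rw [ENNReal.ofReal_mul (by positivity), mul_assoc]
        congr 1
        rw [← lintegral_const_mul' _ _ ENNReal.ofReal_ne_top]
        refine lintegral_congr fun ζ => ?_
        rw [← lintegral_const_mul' _ _ ENNReal.ofReal_ne_top]
        refine lintegral_congr fun η => ?_
        rw [enorm_fourier_gaussian hR, ENNReal.ofReal_mul (by positivity)]
        ring

end GaussianWeight

lemma lintegral_comp_const_smul {E : Type*} [NormedAddCommGroup E] [NormedSpace ℝ E]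
    [FiniteDimensional ℝ E] [MeasurableSpace E] [BorelSpace E] (μ : Measure E)
    [μ.IsAddHaarMeasure] {c : ℝ} (hc : 0 < c) (f : E → ℝ≥0∞) :
    ∫⁻ x, f (c • x) ∂μ = ENNReal.ofReal (c ^ Module.finrank ℝ E)⁻¹ * ∫⁻ x, f x ∂μ := by
  have hmap : Measure.map (c • ·) μ = ENNReal.ofReal (c ^ Module.finrank ℝ E)⁻¹ • μ := by
    rw [Measure.map_addHaar_smul μ hc.ne', abs_of_pos (by positivity)]
  rw [← smul_eq_mul, ← lintegral_smul_measure, ← hmap]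
  exact ((Homeomorph.smulOfNeZero c hc.ne').measurableEmbedding.lintegral_map f).symm

/-! ### Reduction to a quadratic form -/

/-- The quadratic form `∬ h(ξ) h(η) exp(-R²|ξ-η|²/(4π)) dξ dη`, which controls the mean squares of
`e^{tΔ} f` over balls of radius `R` for all `f` with `|f̂| ≤ h`. -/
def gaussForm {n : ℕ} (h : Rn n → ℝ≥0∞) (R : ℝ) : ℝ≥0∞ :=
  ∫⁻ ξ, ∫⁻ η, h ξ * h η * ENNReal.ofReal (Real.exp (-(R ^ 2 * ‖ξ - η‖ ^ 2 / (4 * Real.pi))))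

lemma gaussForm_comp_two_pi_smul {n : ℕ} (h : Rn n → ℝ≥0∞) (R : ℝ) :
    ∫⁻ ζ : Rn n, ∫⁻ η : Rn n, h ((2 * Real.pi) • ζ) * h ((2 * Real.pi) • η) *
        ENNReal.ofReal (Real.exp (-Real.pi * R ^ 2 * ‖ζ - η‖ ^ 2)) =
      ENNReal.ofReal ((2 * Real.pi) ^ n)⁻¹ ^ 2 * gaussForm h R := by
  let k : Rn n → Rn n → ℝ≥0∞ := fun ξ η =>
    h ξ * h η * ENNReal.ofReal (Real.exp (-(R ^ 2 * ‖ξ - η‖ ^ 2 / (4 * Real.pi))))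
  have hpi : 0 < 2 * Real.pi := by positivity
  have hk : ∀ ζ η : Rn n, h ((2 * Real.pi) • ζ) * h ((2 * Real.pi) • η) *
      ENNReal.ofReal (Real.exp (-Real.pi * R ^ 2 * ‖ζ - η‖ ^ 2)) =
      k ((2 * Real.pi) • ζ) ((2 * Real.pi) • η) := fun ζ η => by
    simp only [k]
    rw [← smul_sub, norm_smul, Real.norm_of_nonneg hpi.le]
    congr 3
    field_simp
    ring
  have hinner : ∀ ξ, ∫⁻ η, k ξ ((2 * Real.pi) • η) =
      ENNReal.ofReal ((2 * Real.pi) ^ n)⁻¹ * ∫⁻ η, k ξ η := fun ξ => by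
    rw [lintegral_comp_const_smul volume hpi (k ξ), finrank_euclideanSpace_fin]
  simp only [hk, hinner]
  rw [lintegral_const_mul' _ _ ENNReal.ofReal_ne_top,
    lintegral_comp_const_smul volume hpi fun ξ => ∫⁻ η, k ξ η, finrank_euclideanSpace_fin,
    ← mul_assoc, sq]
  rfl

section Reduction

variable {n : ℕ} {F : Type*} [NormedAddCommGroup F] [InnerProductSpace ℂ F] [CompleteSpace F]
  {h : Rn n → ℝ≥0∞} {f : 𝓢'(Rn n, F)} {g : Rn n → F} {M : ℝ≥0∞} {K : ℝ≥0}

lemma lintegral_ball_enorm_sq_fourierInv_le_gaussForm {v : Rn n → F} (hv : Integrable v)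
    (hM : M ≠ ∞) (hvh : ∀ᵐ ζ, ‖v ζ‖ₑ ≤ M * h ((2 * Real.pi) • ζ)) (x : Rn n) {R : ℝ}
    (hR : 0 < R) :
    ∫⁻ y in Metric.ball x R, ‖𝓕⁻ v y‖ₑ ^ 2 ≤ ENNReal.ofReal (Real.exp Real.pi * R ^ n) *
      (M ^ 2 * (ENNReal.ofReal ((2 * Real.pi) ^ n)⁻¹ ^ 2 * gaussForm h R)) := by
  have hball := lintegral_ball_enorm_sq_fourierInv_le hv x hR
  rw [finrank_euclideanSpace_fin] at hball
  refine hball.trans (mul_le_mul_right ?_ _)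
  rw [← gaussForm_comp_two_pi_smul, ← lintegral_const_mul' _ _ (ENNReal.pow_ne_top hM)]
  refine lintegral_mono_ae ?_
  filter_upwards [hvh] with ζ hζ
  rw [← lintegral_const_mul' _ _ (ENNReal.pow_ne_top hM)]
  refine lintegral_mono_ae ?_
  filter_upwards [hvh] with η hη
  calc _ ≤ (M * h ((2 * Real.pi) • ζ)) * (M * h ((2 * Real.pi) • η)) *
        ENNReal.ofReal (Real.exp (-Real.pi * R ^ 2 * ‖ζ - η‖ ^ 2)) := by gcongr
    _ = _ := by ring

lemma ae_norm_le_of_ae_enorm_le_mul_comp_smul {E : Type*} [NormedAddCommGroup E] {g : Rn n → E}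
    {c : ℝ} (hc : 1 ≤ c) (hM : M ≠ ∞) (hg : ∀ᵐ ζ, ‖g ζ‖ₑ ≤ M * h (c • ζ))
    (hK : ∀ ξ, 1 ≤ ‖ξ‖ → h ξ ≤ K) :
    ∀ᵐ ζ, 1 ≤ ‖ζ‖ → ‖g ζ‖ ≤ (M * K).toReal := by
  filter_upwards [hg] with ζ hζ hr
  rw [← toReal_enorm]
  refine ENNReal.toReal_mono (by finiteness) (hζ.trans (mul_le_mul_right (hK _ ?_) M))
  rw [norm_smul, Real.norm_of_nonneg (by positivity)]
  exact one_le_mul_of_one_le_of_one_le hc hr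

lemma lintegral_ball_enorm_sq_heat_le (hf : HasFourierFunction f g) (hM : M ≠ ∞)
    (hg : ∀ᵐ ξ, ‖g ξ‖ₑ ≤ M * h ξ) (hK : ∀ ξ, 1 ≤ ‖ξ‖ → h ξ ≤ K) {t : ℝ} (ht : 0 < t) (x : Rn n)
    {R : ℝ} (hR : 0 < R) :
    ∫⁻ y in Metric.ball x R, ‖heat t f y‖ₑ ^ 2 ≤
      ENNReal.ofReal (Real.exp Real.pi * R ^ n / (2 * Real.pi) ^ n) * (M ^ 2 * gaussForm h R) := by
  have hpi0 : 0 < 2 * Real.pi := by positivity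
  let c : ℝ := (2 * Real.pi) ^ ((n : ℝ) / 2)
  let G : Rn n → F := fun ζ => (c : ℂ) • g ((2 * Real.pi) • ζ)
  let A : ℝ≥0∞ := ENNReal.ofReal c * M
  have hA : A ≠ ∞ := by finiteness
  have hG : ∀ᵐ ζ, ‖G ζ‖ₑ ≤ A * h ((2 * Real.pi) • ζ) := by
    filter_upwards [(Measure.quasiMeasurePreserving_smul volume hpi0.ne').ae hg] with ζ hζ
    rw [mul_assoc, enorm_smul, ← ofReal_norm, Complex.norm_real,
      Real.norm_of_nonneg (by positivity)]
    gcongr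
  have hbd : ∀ᵐ ζ, 1 ≤ ‖ζ‖ → ‖G ζ‖ ≤ (A * K).toReal :=
    ae_norm_le_of_ae_enorm_le_mul_comp_smul (by linarith [Real.pi_gt_three]) hA hG hK
  have ha : 0 < 4 * Real.pi ^ 2 * t := by positivity
  have hv := integrable_schwartz_smul hf.1 hbd
    ((gaussian n (4 * Real.pi ^ 2 * t) ha).postcompCLM Complex.ofRealCLM)
  have hle : ∀ᵐ ζ, ‖((Real.exp (-(4 * Real.pi ^ 2 * t) * ‖ζ‖ ^ 2) : ℝ) : ℂ) • G ζ‖ₑ ≤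
      A * h ((2 * Real.pi) • ζ) := by
    filter_upwards [hG] with ζ hζ
    rw [enorm_smul]
    refine (mul_le_of_le_one_left zero_le ?_).trans hζ
    rw [← ofReal_norm, Complex.norm_real, Real.norm_of_nonneg (Real.exp_nonneg _),
      ENNReal.ofReal_le_one, Real.exp_le_one_iff]
    nlinarith [sq_nonneg ‖ζ‖]
  simp only [heat_eq_fourierInv hf hbd ht]
  refine (lintegral_ball_enorm_sq_fourierInv_le_gaussForm hv hA hle x hR).trans_eq ?_
  have hc : c ^ 2 * ((2 * Real.pi) ^ n)⁻¹ = 1 := by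
    rw [← Real.rpow_natCast, ← Real.rpow_mul hpi0.le, Nat.cast_ofNat, div_mul_cancel₀ _ two_ne_zero,
      Real.rpow_natCast, mul_inv_cancel₀ (by positivity)]
  calc _ = ENNReal.ofReal (Real.exp Real.pi * R ^ n) * ENNReal.ofReal ((2 * Real.pi) ^ n)⁻¹ *
        ENNReal.ofReal (c ^ 2 * ((2 * Real.pi) ^ n)⁻¹) * (M ^ 2 * gaussForm h R) := by
        rw [ENNReal.ofReal_mul (sq_nonneg c), ENNReal.ofReal_pow (by positivity)]
        ring
    _ = _ := by
        rw [hc, ENNReal.ofReal_one, mul_one, ← ENNReal.ofReal_mul (by positivity), div_eq_mul_inv]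

lemma inv_volume_ball_mul_lintegral_heat_le (hf : HasFourierFunction f g) (hM : M ≠ ∞)
    (hg : ∀ᵐ ξ, ‖g ξ‖ₑ ≤ M * h ξ) (hK : ∀ ξ, 1 ≤ ‖ξ‖ → h ξ ≤ K) (x : Rn n) {R : ℝ} (hR : 0 < R) :
    (volume (Metric.ball x R))⁻¹ *
        ∫⁻ t in Ioo 0 (R ^ 2), ∫⁻ y in Metric.ball x R, ‖heat t f y‖ₑ ^ 2 ≤
      (volume (Metric.ball (0 : Rn n) 1))⁻¹ *
        ENNReal.ofReal (Real.exp Real.pi / (2 * Real.pi) ^ n) *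
          (ENNReal.ofReal (R ^ 2) * gaussForm h R) * M ^ 2 := by
  have hV0 : volume (Metric.ball (0 : Rn n) 1) ≠ 0 :=
    (Metric.measure_ball_pos volume _ one_pos).ne'
  have hRn : ENNReal.ofReal (R ^ n) ≠ 0 := by simp [hR]
  have hvol : volume (Metric.ball x R) =
      ENNReal.ofReal (R ^ n) * volume (Metric.ball (0 : Rn n) 1) := by
    rw [Measure.addHaar_ball_of_pos volume x hR, finrank_euclideanSpace_fin]
  have hheat : ∫⁻ t in Ioo 0 (R ^ 2), ∫⁻ y in Metric.ball x R, ‖heat t f y‖ₑ ^ 2 ≤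
      ENNReal.ofReal (Real.exp Real.pi * R ^ n / (2 * Real.pi) ^ n) * (M ^ 2 * gaussForm h R) *
        ENNReal.ofReal (R ^ 2) := by
    rw [← sub_zero (R ^ 2), ← Real.volume_Ioo, ← setLIntegral_const, sub_zero]
    exact setLIntegral_mono' measurableSet_Ioo fun t ht =>
      lintegral_ball_enorm_sq_heat_le hf hM hg hK ht.1 x hR
  calc _ ≤ _ := mul_le_mul_right hheat _
    _ = (ENNReal.ofReal (R ^ n))⁻¹ * ENNReal.ofReal (R ^ n) *
          ((volume (Metric.ball (0 : Rn n) 1))⁻¹ *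
            ENNReal.ofReal (Real.exp Real.pi / (2 * Real.pi) ^ n) *
              (ENNReal.ofReal (R ^ 2) * gaussForm h R) * M ^ 2) := by
        rw [hvol, ENNReal.mul_inv (Or.inl hRn) (Or.inr hV0), mul_div_right_comm,
          ENNReal.ofReal_mul (by positivity)]
        ring
    _ = _ := by rw [ENNReal.inv_mul_cancel hRn ENNReal.ofReal_ne_top, one_mul]

end Reduction

section BmoBound

variable {n : ℕ} {F : Type*} [NormedAddCommGroup F] [InnerProductSpace ℂ F] [CompleteSpace F]
  {h : Rn n → ℝ≥0∞}

lemma majNorm_lt_top {E : Type*} [NormedAddCommGroup E] [NormedSpace ℂ E] {f : 𝓢'(Rn n, E)}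
    (hf : f ∈ majSpace E h) : majNorm h f < ∞ := by
  obtain ⟨g, hg, hlt⟩ := hf
  exact (iInf₂_le g hg).trans_lt hlt

lemma ae_enorm_le_mul_of_essSup_le {E : Type*} [NormedAddCommGroup E] (hpos : ∀ ξ, 0 < h ξ)
    (hfin : volume {ξ | h ξ = ∞} = 0) {g : Rn n → E} {M : ℝ≥0∞}
    (hM : essSup (fun ξ => (h ξ)⁻¹ * ‖g ξ‖ₑ) volume ≤ M) : ∀ᵐ ξ, ‖g ξ‖ₑ ≤ M * h ξ := by
  have hfin' : ∀ᵐ ξ, h ξ ≠ ∞ := measure_eq_zero_iff_ae_notMem.mp hfin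
  filter_upwards [hfin', ENNReal.ae_le_essSup fun ξ => (h ξ)⁻¹ * ‖g ξ‖ₑ] with ξ hξ hess
  rw [← ENNReal.div_eq_inv_mul] at hess
  exact (ENNReal.div_le_iff (hpos ξ).ne' hξ).mp (hess.trans hM)

lemma bmoNorm_le_of_gaussForm_le {f : 𝓢'(Rn n, F)} {g : Rn n → F} (hf : HasFourierFunction f g)
    {M : ℝ≥0∞} (hM : M ≠ ∞) (hg : ∀ᵐ ξ, ‖g ξ‖ₑ ≤ M * h ξ) {K : ℝ≥0}
    (hK : ∀ ξ, 1 ≤ ‖ξ‖ → h ξ ≤ K) {T : ℝ} {D S : ℝ≥0∞}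
    (hD : ∀ R, 0 < R → R ^ 2 < T → ENNReal.ofReal (R ^ 2) * gaussForm h R ≤ D * S ^ 2) :
    bmoNorm T f ≤ ((volume (Metric.ball (0 : Rn n) 1))⁻¹ *
      ENNReal.ofReal (Real.exp Real.pi / (2 * Real.pi) ^ n) * D) ^ (1 / 2 : ℝ) * S * M := by
  let Q : ℝ≥0∞ := (volume (Metric.ball (0 : Rn n) 1))⁻¹ *
    ENNReal.ofReal (Real.exp Real.pi / (2 * Real.pi) ^ n) * D
  refine iSup₂_le fun x R => iSup₂_le fun hR hRT => ?_
  have hsq : (volume (Metric.ball x R))⁻¹ *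
      ∫⁻ t in Ioo 0 (R ^ 2), ∫⁻ y in Metric.ball x R, ‖heat t f y‖ₑ ^ 2 ≤ Q * (S * M) ^ 2 := by
    refine (inv_volume_ball_mul_lintegral_heat_le hf hM hg hK x hR).trans ?_
    calc _ ≤ _ := mul_le_mul_left (mul_le_mul_right (hD R hR hRT) _) _
      _ = _ := by ring
  calc _ ≤ (Q * (S * M) ^ 2) ^ (1 / 2 : ℝ) := by gcongr
    _ = _ := by
      rw [ENNReal.mul_rpow_of_nonneg _ _ (by norm_num), ← ENNReal.rpow_natCast,
        ← ENNReal.rpow_mul]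
      norm_num [Q, mul_assoc]

theorem exists_bmoNorm_le_mul_majNorm (hpos : ∀ ξ, 0 < h ξ) (hfin : volume {ξ | h ξ = ∞} = 0)
    {K : ℝ≥0} (hK : ∀ ξ, 1 ≤ ‖ξ‖ → h ξ ≤ K) {φ : ℝ → ℝ} {D : ℝ≥0}
    (hD : ∀ T R, 0 < R → R ^ 2 < T →
      ENNReal.ofReal (R ^ 2) * gaussForm h R ≤ D * ENNReal.ofReal (φ T) ^ 2) :
    ∃ C : ℝ≥0, ∀ f ∈ majSpace F h, ∀ T : ℝ,
      bmoNorm T f ≤ C * ENNReal.ofReal (φ T) * majNorm h f := by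
  let Q : ℝ≥0∞ := ((volume (Metric.ball (0 : Rn n) 1))⁻¹ *
    ENNReal.ofReal (Real.exp Real.pi / (2 * Real.pi) ^ n) * D) ^ (1 / 2 : ℝ)
  have hQ : Q ≠ ∞ := by
    have : (volume (Metric.ball (0 : Rn n) 1))⁻¹ ≠ ∞ :=
      ENNReal.inv_ne_top.mpr (Metric.measure_ball_pos volume _ one_pos).ne'
    finiteness
  refine ⟨Q.toNNReal, fun f hf T => ?_⟩
  rw [ENNReal.coe_toNNReal hQ]
  have hbound : ∀ M > majNorm h f, M < ∞ → bmoNorm T f ≤ Q * ENNReal.ofReal (φ T) * M :=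
    fun M hM hMt => by
      obtain ⟨g, hg, hgM⟩ := (by simpa only [majNorm, gt_iff_lt, iInf_lt_iff] using hM :
        ∃ g, ∃ _ : HasFourierFunction f g, essSup (fun ξ => (h ξ)⁻¹ * ‖g ξ‖ₑ) volume < M)
      exact bmoNorm_le_of_gaussForm_le hg hMt.ne (ae_enorm_le_mul_of_essSup_le hpos hfin hgM.le)
        hK (hD T)
  have hlt := majNorm_lt_top hf
  have : (𝓝[>] majNorm h f).NeBot := nhdsGT_neBot_of_exists_gt ⟨∞, hlt⟩
  have hlim : Tendsto (fun M => Q * ENNReal.ofReal (φ T) * M) (𝓝[>] majNorm h f)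
      (𝓝 (Q * ENNReal.ofReal (φ T) * majNorm h f)) :=
    ENNReal.Tendsto.const_mul (tendsto_nhdsWithin_of_tendsto_nhds tendsto_id)
      (Or.inr (by finiteness))
  refine ge_of_tendsto hlim ?_
  filter_upwards [self_mem_nhdsWithin, nhdsWithin_le_nhds (gt_mem_nhds hlt)] with M hM hMt
    using hbound M hM hMt

lemma continuouslyEmbeds_vmoSpace {E : Type*} [NormedAddCommGroup E] [NormedSpace ℂ E]
    {φ : ℝ → ℝ} (hφ : Tendsto φ (𝓝[>] 0) (𝓝 0))
    (hb : ∃ C : ℝ≥0, ∀ f ∈ majSpace E h, ∀ T : ℝ, 0 < T →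
      bmoNorm T f ≤ C * ENNReal.ofReal (φ T) * majNorm h f) :
    ContinuouslyEmbeds (majSpace E h) (majNorm h) (vmoSpace n E) (bmoNorm 1) := by
  obtain ⟨C, hC⟩ := hb
  have hC1 : ∀ f ∈ majSpace E h, bmoNorm 1 f ≤ (C * (φ 1).toNNReal : ℝ≥0) * majNorm h f :=
    fun f hf => by rw [ENNReal.coe_mul]; exact hC f hf 1 one_pos
  refine ⟨fun f hf => ⟨(hC1 f hf).trans_lt ?_, ?_⟩, C * (φ 1).toNNReal, hC1⟩
  · exact ENNReal.mul_lt_top ENNReal.coe_lt_top (majNorm_lt_top hf)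
  · have hlim : Tendsto (fun T => C * ENNReal.ofReal (φ T) * majNorm h f) (𝓝[>] 0) (𝓝 0) := by
      have hlim' := ENNReal.Tendsto.mul_const (ENNReal.Tendsto.const_mul
        (ENNReal.tendsto_ofReal hφ) (Or.inr (ENNReal.coe_ne_top (r := C))))
        (Or.inr (majNorm_lt_top hf).ne)
      simpa using hlim'
    refine tendsto_of_tendsto_of_tendsto_of_le_of_le' tendsto_const_nhds hlim
      (Eventually.of_forall fun _ => zero_le) ?_
    filter_upwards [self_mem_nhdsWithin] with T hT using hC f hf T hT

end BmoBound

/-! ### Growth of majorizing kernels -/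

lemma exists_forall_ne_zero_le_mul {E : Type*} [NormedAddCommGroup E] {u v : E → ℝ≥0∞}
    (hzero : ∃ C : ℝ≥0, ∀ᶠ ξ in 𝓝[≠] 0, u ξ ≤ C * v ξ)
    (hinfty : ∃ C : ℝ≥0, ∀ᶠ ξ in Bornology.cobounded E, u ξ ≤ C * v ξ)
    (hu : ∀ r > 0, ∃ M : ℝ≥0, ∀ ξ, r ≤ ‖ξ‖ → u ξ ≤ M)
    (hv : ∀ ρ, ∃ c : ℝ≥0, 0 < c ∧ ∀ ξ, ξ ≠ 0 → ‖ξ‖ ≤ ρ → c ≤ v ξ) :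
    ∃ C : ℝ≥0, ∀ ξ, ξ ≠ 0 → u ξ ≤ C * v ξ := by
  obtain ⟨C₁, h₁⟩ := hzero
  obtain ⟨r, hr, hball⟩ := Metric.eventually_nhds_iff.mp (eventually_nhdsWithin_iff.mp h₁)
  obtain ⟨C₂, h₂⟩ := hinfty
  obtain ⟨ρ, -, hρ⟩ := (hasBasis_cobounded_norm (E := E)).eventually_iff.mp h₂
  obtain ⟨M, hM⟩ := hu r hr
  obtain ⟨c, hc0, hc⟩ := hv ρ
  refine ⟨max (max C₁ C₂) (M * c⁻¹), fun ξ hξ => ?_⟩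
  rw [ENNReal.coe_max, ENNReal.coe_max, ENNReal.coe_mul]
  rcases lt_or_ge ‖ξ‖ r with hlt | hge
  · refine (hball (by rwa [dist_zero_right]) hξ).trans (mul_le_mul_left ?_ _)
    exact (le_max_left _ _).trans (le_max_left _ _)
  rcases le_or_gt ρ ‖ξ‖ with hge' | hlt'
  · refine (hρ hge').trans (mul_le_mul_left ?_ _)
    exact (le_max_right _ _).trans (le_max_left _ _)
  · have hone : 1 = ((c⁻¹ : ℝ≥0) : ℝ≥0∞) * c := by
      rw [← ENNReal.coe_mul, inv_mul_cancel₀ hc0.ne', ENNReal.coe_one]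
    calc u ξ ≤ M := hM ξ hge
      _ = M * (c⁻¹ : ℝ≥0) * c := by rw [mul_assoc, ← hone, mul_one]
      _ ≤ M * (c⁻¹ : ℝ≥0) * v ξ := mul_le_mul_right (hc ξ hξ hlt'.le) _
      _ ≤ _ := mul_le_mul_left (le_max_right _ _) _

section Kernel

variable {n : ℕ} {θ α ω a : ℝ} {h : Rn n → ℝ≥0∞}

lemma BehavesAlong.exists_bounds {l : Filter (Rn n)} (hb : BehavesAlong l a h) :
    ∃ c > 0, ∃ C > 0, ∀ᶠ ξ in l,
      ENNReal.ofReal (c * ‖ξ‖ ^ (-a)) ≤ h ξ ∧ h ξ ≤ ENNReal.ofReal (C * ‖ξ‖ ^ (-a)) := by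
  obtain ⟨⟨C₁, h₁⟩, C₂, h₂⟩ := hb
  refine ⟨((C₂ : ℝ) + 1)⁻¹, by positivity, C₁ + 1, by positivity, ?_⟩
  filter_upwards [h₁, h₂] with ξ hup hlow
  constructor
  · rw [ENNReal.ofReal_mul (by positivity), ENNReal.ofReal_inv_of_pos (by positivity),
      ← ENNReal.div_eq_inv_mul]
    refine ENNReal.div_le_of_le_mul' (hlow.trans (mul_le_mul_left ?_ _))
    rw [← ENNReal.ofReal_coe_nnreal]
    exact ENNReal.ofReal_le_ofReal (by linarith)
  · rw [ENNReal.ofReal_mul (by positivity)]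
    refine hup.trans (mul_le_mul_left ?_ _)
    rw [← ENNReal.ofReal_coe_nnreal]
    exact ENNReal.ofReal_le_ofReal (by linarith)

lemma BehavesAlong.exists_bounds_near_zero (hb : BehavesAlong (𝓝[≠] 0) a h) :
    ∃ c > 0, ∃ C > 0, ∃ r > 0, ∀ ξ, ξ ≠ 0 → ‖ξ‖ < r →
      ENNReal.ofReal (c * ‖ξ‖ ^ (-a)) ≤ h ξ ∧ h ξ ≤ ENNReal.ofReal (C * ‖ξ‖ ^ (-a)) := by
  obtain ⟨c, hc, C, hC, hev⟩ := hb.exists_bounds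
  obtain ⟨r, hr, hball⟩ := Metric.eventually_nhds_iff.mp (eventually_nhdsWithin_iff.mp hev)
  exact ⟨c, hc, C, hC, r, hr, fun ξ hξ hlt => hball (by rwa [dist_zero_right]) hξ⟩

lemma BehavesAlong.exists_bounds_near_infinity
    (hb : BehavesAlong (Bornology.cobounded (Rn n)) a h) :
    ∃ c > 0, ∃ C > 0, ∃ ρ ≥ 1, ∀ ξ, ρ ≤ ‖ξ‖ →
      ENNReal.ofReal (c * ‖ξ‖ ^ (-a)) ≤ h ξ ∧ h ξ ≤ ENNReal.ofReal (C * ‖ξ‖ ^ (-a)) := by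
  obtain ⟨c, hc, C, hC, hev⟩ := hb.exists_bounds
  obtain ⟨ρ, -, hρ⟩ := (hasBasis_cobounded_norm (E := Rn n)).eventually_iff.mp hev
  exact ⟨c, hc, C, hC, max ρ 1, le_max_right _ _, fun ξ hξ => hρ ((le_max_left _ _).trans hξ)⟩

lemma BehavesAlong.exists_neg_le_mul {l : Filter (Rn n)} (hb : BehavesAlong l a h)
    (hl : Tendsto Neg.neg l l) : ∃ K : ℝ≥0, ∀ᶠ ξ in l, h (-ξ) ≤ K * h ξ := by
  obtain ⟨⟨C₁, h₁⟩, C₂, h₂⟩ := hb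
  refine ⟨C₁ * C₂, ?_⟩
  filter_upwards [hl.eventually h₁, h₂] with ξ hup hlow
  rw [norm_neg] at hup
  rw [ENNReal.coe_mul, mul_assoc]
  exact hup.trans (mul_le_mul_right hlow _)

lemma sq_mul_volume_ball_le_selfConv {d : ℝ≥0∞} {r : ℝ} {y z : Rn n}
    (hy : ∀ η ∈ Metric.ball y r, d ≤ h η) (hz : ∀ η ∈ Metric.ball z r, d ≤ h η) :
    d ^ 2 * volume (Metric.ball (0 : Rn n) r) ≤ selfConv h (y + z) := by
  rw [← Measure.addHaar_ball_center volume z, ← setLIntegral_const, sq]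
  refine (setLIntegral_mono' measurableSet_ball fun η hη => ?_).trans
    (setLIntegral_le_lintegral (Metric.ball z r) fun η => h (y + z - η) * h η)
  refine mul_le_mul' (hy _ ?_) (hz η hη)
  rwa [mem_ball_iff_norm, add_sub_assoc, add_sub_cancel_left, ← mem_ball_iff_norm']

lemma ofReal_mul_rpow_neg_le_of_mem_ball (ha : 0 ≤ a) {c r s : ℝ} (hc : 0 ≤ c) {y η : Rn n}
    (hr : r ≤ ‖y‖) (hs : ‖y‖ + r ≤ s)
    (hlow : ∀ ξ, ‖y‖ - r ≤ ‖ξ‖ → ‖ξ‖ ≤ s → ENNReal.ofReal (c * ‖ξ‖ ^ (-a)) ≤ h ξ)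
    (hη : η ∈ Metric.ball y r) : ENNReal.ofReal (c * s ^ (-a)) ≤ h η := by
  have hle := norm_lt_of_mem_ball hη
  have hge := norm_lt_of_mem_ball (Metric.mem_ball_comm.mp hη)
  refine le_trans (ENNReal.ofReal_le_ofReal ?_) (hlow η (by linarith) (by linarith))
  have := Real.rpow_le_rpow_of_nonpos (show 0 < ‖η‖ by linarith) (show ‖η‖ ≤ s by linarith)
    (neg_nonpos.mpr ha)
  gcongr

lemma rpow_sub_sub_le_of_sq_mul_le {s c C V B : ℝ} (hs : 0 < s) (hc : 0 < c) (hV : 0 < V)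
    (hle : (c * s ^ (-a)) ^ 2 * ((s / 4) ^ n * V) ≤ B * s ^ θ * (C * s ^ (-a))) :
    s ^ ((n : ℝ) - a - θ) ≤ B * C * 4 ^ n / (c ^ 2 * V) := by
  have hsplit : s ^ ((n : ℝ) - a - θ) = s ^ n * s ^ (-a) / s ^ θ := by
    rw [sub_eq_add_neg (n : ℝ) a, Real.rpow_sub hs, Real.rpow_add hs, Real.rpow_natCast]
  rw [hsplit, div_le_div_iff₀ (by positivity) (by positivity)]
  refine le_of_mul_le_mul_left ?_ (show 0 < s ^ (-a) / 4 ^ n by positivity)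
  calc _ = (c * s ^ (-a)) ^ 2 * ((s / 4) ^ n * V) := by rw [div_pow]; ring
    _ ≤ _ := hle
    _ = _ := by field_simp

/-- Tests the convolution inequality at a point of norm `s`, where both factors of the convolution
are of size `s^{-a}` on a ball of radius comparable to `s`. -/
lemma IsMajorizingKernel.exists_rpow_le (hh : IsMajorizingKernel θ h) (hn : 0 < n) (ha : 0 ≤ a)
    {c C : ℝ} (hc : 0 < c) (hC : 0 < C) :
    ∃ L : ℝ, ∀ s : ℝ, 0 < s → (∀ η : Rn n, s / 4 ≤ ‖η‖ → ‖η‖ ≤ s →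
      ENNReal.ofReal (c * ‖η‖ ^ (-a)) ≤ h η ∧ h η ≤ ENNReal.ofReal (C * ‖η‖ ^ (-a))) →
      s ^ ((n : ℝ) - a - θ) ≤ L := by
  obtain ⟨B, hB, hconv⟩ := hh.conv_le
  have : Nonempty (Fin n) := ⟨⟨0, hn⟩⟩
  let V := volume.real (Metric.ball (0 : Rn n) 1)
  have hV : 0 < V := ENNReal.toReal_pos (Metric.measure_ball_pos volume _ one_pos).ne'
    measure_ball_lt_top.ne
  refine ⟨B * C * 4 ^ n / (c ^ 2 * V), fun s hs hbd => ?_⟩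
  obtain ⟨z, hz⟩ := exists_norm_eq (Rn n) (half_pos hs).le
  have hzz : ‖z + z‖ = s := by
    rw [← two_smul ℝ z, norm_smul, hz, Real.norm_two, mul_div_cancel₀ _ two_ne_zero]
  have hlow : ∀ η ∈ Metric.ball z (s / 4), ENNReal.ofReal (c * s ^ (-a)) ≤ h η :=
    fun η => ofReal_mul_rpow_neg_le_of_mem_ball ha hc.le (by linarith) (by linarith)
      fun ξ hge hle => (hbd ξ (by linarith) hle).1
  have hup := (hbd (z + z) (by linarith) hzz.le).2
  have hconv_z := hconv (z + z) (hup.trans_lt ENNReal.ofReal_lt_top).ne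
  rw [hzz] at hup hconv_z
  have hball : volume (Metric.ball (0 : Rn n) (s / 4)) = ENNReal.ofReal ((s / 4) ^ n * V) := by
    rw [Measure.addHaar_ball volume _ (by positivity), finrank_euclideanSpace_fin,
      ENNReal.ofReal_mul (by positivity), ofReal_measureReal]
  refine rpow_sub_sub_le_of_sq_mul_le hs hc hV ?_
  rw [← ENNReal.ofReal_le_ofReal_iff (by positivity), ENNReal.ofReal_mul (by positivity),
    ENNReal.ofReal_pow (by positivity), ← hball,
    ENNReal.ofReal_mul (p := B * s ^ θ) (by positivity)]
  exact (sq_mul_volume_ball_le_selfConv hlow hlow).trans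
    (hconv_z.trans (mul_le_mul_right hup _))

lemma IsRadialMajorizingKernel.alpha_le (hh : IsRadialMajorizingKernel θ α ω h) (hn : 0 < n) :
    α ≤ n - θ := by
  obtain ⟨c, hc, C, hC, r, hr, hbd⟩ := hh.at_origin.exists_bounds_near_zero
  obtain ⟨L, hL⟩ := hh.exists_rpow_le hn hh.alpha_nonneg hc hC
  by_contra! hlt
  have hlim : Tendsto (fun s : ℝ => s ^ ((n : ℝ) - α - θ)) (𝓝[>] 0) atTop :=
    tendsto_rpow_neg_nhdsGT_zero (by linarith)
  have hsmall : ∀ᶠ s : ℝ in 𝓝[>] 0, s < r := nhdsWithin_le_nhds (gt_mem_nhds hr)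
  obtain ⟨s, ⟨hLs, hsr⟩, hs : 0 < s⟩ :=
    ((hlim.eventually_gt_atTop L).and hsmall |>.and self_mem_nhdsWithin).exists
  refine (hL s hs fun η hge hle => hbd η (norm_pos_iff.mp ?_) (hle.trans_lt hsr)).not_gt hLs
  linarith

lemma IsRadialMajorizingKernel.le_omega (hh : IsRadialMajorizingKernel θ α ω h) (hn : 0 < n) :
    n - θ ≤ ω := by
  obtain ⟨c, hc, C, hC, ρ, hρ, hbd⟩ := hh.at_infinity.exists_bounds_near_infinity
  obtain ⟨L, hL⟩ := hh.exists_rpow_le hn hh.omega_pos.le hc hC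
  by_contra! hlt
  have hlim : Tendsto (fun s : ℝ => s ^ ((n : ℝ) - ω - θ)) atTop atTop :=
    tendsto_rpow_atTop (by linarith)
  obtain ⟨s, hLs, hs⟩ :=
    ((hlim.eventually_gt_atTop L).and (eventually_ge_atTop (4 * ρ))).exists
  exact (hL s (by linarith) fun η hge _ => hbd η (by linarith)).not_gt hLs

lemma IsRadialMajorizingKernel.exists_le_of_le_norm (hh : IsRadialMajorizingKernel θ α ω h) {r : ℝ}
    (hr : 0 < r) : ∃ M : ℝ≥0, ∀ ξ, r ≤ ‖ξ‖ → h ξ ≤ M := by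
  obtain ⟨M, hM⟩ := hh.bounded_away (Metric.ball 0 r) (Metric.ball_mem_nhds 0 hr)
  exact ⟨M, fun ξ hξ => hM ξ (by simpa using hξ)⟩

lemma IsRadialMajorizingKernel.exists_le_mul_rpow (hh : IsRadialMajorizingKernel θ α ω h)
    (hn : 0 < n) : ∃ C : ℝ≥0, ∀ ξ, ξ ≠ 0 → h ξ ≤ C * ENNReal.ofReal (‖ξ‖ ^ (θ - n)) := by
  have hα := hh.alpha_le hn
  have hω := hh.le_omega hn
  have hα0 := hh.alpha_nonneg
  refine exists_forall_ne_zero_le_mul ?_ ?_ (fun r hr => hh.exists_le_of_le_norm hr) fun ρ => ?_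
  · obtain ⟨C, hC⟩ := hh.at_origin.1
    refine ⟨C, ?_⟩
    filter_upwards [hC, nhdsWithin_le_nhds (Metric.ball_mem_nhds 0 one_pos),
      self_mem_nhdsWithin] with ξ hle hball hξ
    refine hle.trans (mul_le_mul_right (ENNReal.ofReal_le_ofReal ?_) _)
    exact Real.rpow_le_rpow_of_exponent_ge (norm_pos_iff.mpr hξ) (mem_ball_zero_iff.mp hball).le
      (by linarith)
  · obtain ⟨C, hC⟩ := hh.at_infinity.1
    refine ⟨C, ?_⟩
    filter_upwards [hC, (hasBasis_cobounded_norm (E := Rn n)).mem_of_mem (i := 1) trivial]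
      with ξ hle hξ
    refine hle.trans (mul_le_mul_right (ENNReal.ofReal_le_ofReal ?_) _)
    exact Real.rpow_le_rpow_of_exponent_le hξ (by linarith)
  · refine ⟨(max ρ 1 ^ (θ - n)).toNNReal, ?_, fun ξ hξ hle => ?_⟩
    · exact Real.toNNReal_pos.mpr (by positivity)
    · exact ENNReal.ofReal_le_ofReal (Real.rpow_le_rpow_of_nonpos (norm_pos_iff.mpr hξ)
        (hle.trans (le_max_left _ _)) (by linarith))

/-- Writes `ξ = (ξ - z) + z` with `z` far away: near both summands `h` is bounded below by its
behavior at infinity. -/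
lemma IsRadialMajorizingKernel.exists_pos_le_of_norm_le (hh : IsRadialMajorizingKernel θ α ω h)
    (hn : 0 < n) (ρ : ℝ) : ∃ c : ℝ≥0, 0 < c ∧ ∀ ξ, ‖ξ‖ ≤ ρ → c ≤ h ξ := by
  obtain ⟨B, hB, hconv⟩ := hh.conv_le
  obtain ⟨c, hc, C, hC, σ, hσ, hbd⟩ := hh.at_infinity.exists_bounds_near_infinity
  have : Nonempty (Fin n) := ⟨⟨0, hn⟩⟩
  let τ := max ρ σ
  have hστ : σ ≤ τ := le_max_right _ _
  have hτ : 0 < τ := by linarith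
  obtain ⟨z, hz⟩ := exists_norm_eq (Rn n) (show 0 ≤ 3 * τ by positivity)
  let W : ℝ≥0∞ :=
    ENNReal.ofReal (c * (5 * τ) ^ (-ω)) ^ 2 * volume (Metric.ball (0 : Rn n) 1)
  have hW : W ≠ 0 := mul_ne_zero (pow_ne_zero _ (ENNReal.ofReal_pos.mpr (by positivity)).ne')
    (Metric.measure_ball_pos volume _ one_pos).ne'
  have hW_top : W / ENNReal.ofReal (B * τ ^ θ) ≠ ∞ :=
    ENNReal.div_ne_top (by finiteness) (ENNReal.ofReal_pos.mpr (by positivity)).ne'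
  refine ⟨(W / ENNReal.ofReal (B * τ ^ θ)).toNNReal, ENNReal.toNNReal_pos
    (ENNReal.div_ne_zero.mpr ⟨hW, ENNReal.ofReal_ne_top⟩) hW_top, fun ξ hξ => ?_⟩
  rw [ENNReal.coe_toNNReal hW_top]
  rcases eq_or_ne (h ξ) ∞ with htop | hfin
  · exact htop ▸ le_top
  have hξτ : ‖ξ‖ ≤ τ := hξ.trans (le_max_left _ _)
  have hlow : ∀ y, 2 * τ ≤ ‖y‖ → ‖y‖ ≤ 4 * τ → ∀ η ∈ Metric.ball y 1,
      ENNReal.ofReal (c * (5 * τ) ^ (-ω)) ≤ h η := fun y hy hy' η =>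
    ofReal_mul_rpow_neg_le_of_mem_ball hh.omega_pos.le hc.le (by linarith) (by linarith)
      fun ξ hge _ => (hbd ξ (by linarith)).1
  have hge := norm_sub_norm_le z ξ
  rw [norm_sub_rev] at hge
  have hle := norm_sub_le ξ z
  have hW_le : W ≤ selfConv h ξ := by
    rw [← sub_add_cancel ξ z]
    exact sq_mul_volume_ball_le_selfConv (hlow _ (by linarith) (by linarith))
      (hlow _ (by linarith) (by linarith))
  refine ENNReal.div_le_of_le_mul' (hW_le.trans ((hconv ξ hfin).trans (mul_le_mul_left ?_ _)))
  have := Real.rpow_le_rpow (norm_nonneg ξ) hξτ hh.exponent_nonneg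
  gcongr

lemma IsRadialMajorizingKernel.exists_neg_le_mul (hh : IsRadialMajorizingKernel θ α ω h)
    (hn : 0 < n) : ∃ K : ℝ≥0, ∀ ξ, ξ ≠ 0 → h (-ξ) ≤ K * h ξ := by
  refine exists_forall_ne_zero_le_mul (hh.at_origin.exists_neg_le_mul ?_)
    (hh.at_infinity.exists_neg_le_mul tendsto_neg_cobounded) (fun r hr => ?_) fun ρ => ?_
  · refine tendsto_nhdsWithin_iff.mpr ⟨?_, ?_⟩
    · simpa using (continuous_neg.tendsto (0 : Rn n)).mono_left nhdsWithin_le_nhds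
    · filter_upwards [self_mem_nhdsWithin] with ξ hξ using neg_ne_zero.mpr hξ
  · obtain ⟨M, hM⟩ := hh.exists_le_of_le_norm hr
    exact ⟨M, fun ξ hξ => hM _ (by rwa [norm_neg])⟩
  · obtain ⟨c, hc0, hc⟩ := hh.exists_pos_le_of_norm_le hn ρ
    exact ⟨c, hc0, fun ξ _ => hc ξ⟩

lemma IsMajorizingKernel.ae_ne_top (hh : IsMajorizingKernel θ h) : ∀ᵐ ξ, h ξ ≠ ∞ :=
  measure_eq_zero_iff_ae_notMem.mp hh.finite_ae

lemma IsMajorizingKernel.lintegral_ball_lt_top (hh : IsMajorizingKernel θ h) (r : ℝ) :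
    ∫⁻ ξ in Metric.ball 0 r, h ξ < ∞ := by
  obtain ⟨u, hu, -⟩ := hh.tempered
  refine lt_of_le_of_lt ?_
    (hu.integrableOn_isCompact (isCompact_closedBall (0 : Rn n) r)).hasFiniteIntegral
  refine (lintegral_mono_set Metric.ball_subset_closedBall).trans
    (lintegral_mono_ae (ae_restrict_of_ae ?_))
  filter_upwards [hh.ae_ne_top] with ξ hξ
  rw [← ofReal_norm, Complex.norm_real, Real.norm_of_nonneg ENNReal.toReal_nonneg,
    ENNReal.ofReal_toReal hξ]

end Kernel

/-! ### Radial integrals -/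

lemma rpow_neg_le_mul_one_add_rpow_neg {r s : ℝ} (hr : 1 ≤ r) (hs : 0 ≤ s) :
    r ^ (-s) ≤ 2 ^ s * (1 + r) ^ (-s) := by
  calc r ^ (-s) = 2 ^ s * (2 * r) ^ (-s) := by
        rw [Real.mul_rpow zero_le_two (by linarith), ← mul_assoc, ← Real.rpow_add two_pos,
          add_neg_cancel, Real.rpow_zero, one_mul]
    _ ≤ _ := by
        have := Real.rpow_le_rpow_of_nonpos (show 0 < 1 + r by linarith)
          (show 1 + r ≤ 2 * r by linarith) (neg_nonpos.mpr hs)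
        gcongr

lemma pow_sub_one_mul_rpow {y : ℝ} (hy : 0 < y) {d : ℕ} (hd : 0 < d) (s : ℝ) :
    y ^ (d - 1) * y ^ s = y ^ (d - 1 + s : ℝ) := by
  rw [← Real.rpow_natCast, Nat.cast_pred hd, ← Real.rpow_add hy]

lemma ofReal_exp_neg_le_one {s : ℝ} (hs : 0 ≤ s) : ENNReal.ofReal (Real.exp (-s)) ≤ 1 := by
  rw [ENNReal.ofReal_le_one, Real.exp_le_one_iff]
  exact neg_nonpos.mpr hs

lemma rpow_neg_mul_gaussian_le {r R : ℝ} (hr : 1 ≤ r) (hR : 0 < R) (d : ℝ) :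
    ENNReal.ofReal (r ^ (-d)) * ENNReal.ofReal (Real.exp (-(R ^ 2 * r ^ 2 / (4 * Real.pi)))) ≤
      ENNReal.ofReal ((Icc 1 (max 1 R⁻¹)).indicator (fun y => y ^ (-d)) r) +
        ENNReal.ofReal R * (ENNReal.ofReal (r ^ (1 - d)) *
          ENNReal.ofReal (Real.exp (-(R ^ 2 * r ^ 2 / (4 * Real.pi))))) := by
  have hr0 : 0 < r := by linarith
  rcases le_or_gt r (max 1 R⁻¹) with hle | hgt
  · rw [indicator_of_mem (show r ∈ Icc 1 (max 1 R⁻¹) from ⟨hr, hle⟩)]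
    exact (mul_le_of_le_one_right' (ofReal_exp_neg_le_one (by positivity))).trans le_self_add
  · refine le_trans ?_ le_add_self
    rw [← mul_assoc, ← ENNReal.ofReal_mul hR.le, sub_eq_add_neg, Real.rpow_add hr0, Real.rpow_one,
      ← mul_assoc]
    refine mul_le_mul_left (ENNReal.ofReal_le_ofReal (le_mul_of_one_le_left (by positivity) ?_)) _
    rw [← inv_le_iff_one_le_mul₀' hR]
    exact (le_max_right _ _).trans hgt.le

section Radial

variable {E : Type*} [NormedAddCommGroup E] [NormedSpace ℝ E] [FiniteDimensional ℝ E]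
  [MeasurableSpace E] [BorelSpace E] (μ : Measure E) [μ.IsAddHaarMeasure]

lemma lintegral_rpow_neg_compl_ball_lt_top {s : ℝ} (hs : Module.finrank ℝ E < s) :
    ∫⁻ x in (Metric.ball (0 : E) 1)ᶜ, ENNReal.ofReal (‖x‖ ^ (-s)) ∂μ < ∞ := by
  have hs0 : 0 ≤ s := (Nat.cast_nonneg _).trans hs.le
  calc _ ≤ ∫⁻ x in (Metric.ball (0 : E) 1)ᶜ,
          ENNReal.ofReal (2 ^ s) * ENNReal.ofReal ((1 + ‖x‖) ^ (-s)) ∂μ := by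
        refine setLIntegral_mono' measurableSet_ball.compl fun x hx => ?_
        rw [← ENNReal.ofReal_mul (by positivity)]
        exact ENNReal.ofReal_le_ofReal
          (rpow_neg_le_mul_one_add_rpow_neg (by simpa using hx) hs0)
    _ ≤ ∫⁻ x, ENNReal.ofReal (2 ^ s) * ENNReal.ofReal ((1 + ‖x‖) ^ (-s)) ∂μ :=
        setLIntegral_le_lintegral _ _
    _ = ENNReal.ofReal (2 ^ s) * ∫⁻ x, ENNReal.ofReal ((1 + ‖x‖) ^ (-s)) ∂μ :=
        lintegral_const_mul' _ _ ENNReal.ofReal_ne_top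
    _ < ∞ := ENNReal.mul_lt_top ENNReal.ofReal_lt_top (finite_integral_one_add_norm hs)

lemma lintegral_rpow_mul_gaussian_comp_smul {R : ℝ} (hR : 0 < R) (s : ℝ) :
    ∫⁻ x, ENNReal.ofReal (‖x‖ ^ s) *
        ENNReal.ofReal (Real.exp (-(R ^ 2 * ‖x‖ ^ 2 / (4 * Real.pi)))) ∂μ =
      ENNReal.ofReal (R ^ (-s - Module.finrank ℝ E)) * ∫⁻ x, ENNReal.ofReal (‖x‖ ^ s) *
        ENNReal.ofReal (Real.exp (-(‖x‖ ^ 2 / (4 * Real.pi)))) ∂μ := by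
  have hscale : ∀ x : E, ENNReal.ofReal (‖x‖ ^ s) *
      ENNReal.ofReal (Real.exp (-(R ^ 2 * ‖x‖ ^ 2 / (4 * Real.pi)))) =
      ENNReal.ofReal (R ^ (-s)) * (ENNReal.ofReal (‖R • x‖ ^ s) *
        ENNReal.ofReal (Real.exp (-(‖R • x‖ ^ 2 / (4 * Real.pi))))) := fun x => by
    rw [norm_smul, Real.norm_of_nonneg hR.le, mul_pow, Real.mul_rpow hR.le (norm_nonneg x),
      ← mul_assoc (ENNReal.ofReal (R ^ (-s))),
      ← ENNReal.ofReal_mul (Real.rpow_nonneg hR.le (-s)), ← mul_assoc (R ^ (-s)),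
      ← Real.rpow_add hR, neg_add_cancel, Real.rpow_zero, one_mul]
  simp only [hscale]
  rw [lintegral_const_mul' _ _ ENNReal.ofReal_ne_top,
    lintegral_comp_const_smul μ hR fun x => ENNReal.ofReal (‖x‖ ^ s) *
      ENNReal.ofReal (Real.exp (-(‖x‖ ^ 2 / (4 * Real.pi)))),
    ← mul_assoc, ← ENNReal.ofReal_mul (by positivity), Real.rpow_sub hR, Real.rpow_natCast,
    div_eq_mul_inv]

variable [Nontrivial E]

lemma lintegral_ofReal_fun_norm {f : ℝ → ℝ} (hf : ∀ y, 0 ≤ y → 0 ≤ f y)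
    (hi : IntegrableOn (fun y => y ^ (Module.finrank ℝ E - 1) * f y) (Ioi 0)) :
    ∫⁻ x, ENNReal.ofReal (f ‖x‖) ∂μ = ENNReal.ofReal (Module.finrank ℝ E *
      μ.real (Metric.ball 0 1) * ∫ y in Ioi 0, y ^ (Module.finrank ℝ E - 1) * f y) := by
  rw [← ofReal_integral_eq_lintegral_ofReal ((integrable_fun_norm_addHaar μ).mpr hi)
    (ae_of_all _ fun x => hf _ (norm_nonneg x)), integral_fun_norm_addHaar, nsmul_eq_mul,
    smul_eq_mul, mul_assoc]
  rfl

lemma lintegral_rpow_mul_gaussian_lt_top {s : ℝ} (hs : -Module.finrank ℝ E < s) :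
    ∫⁻ x, ENNReal.ofReal (‖x‖ ^ s) *
      ENNReal.ofReal (Real.exp (-(‖x‖ ^ 2 / (4 * Real.pi)))) ∂μ < ∞ := by
  have hint : IntegrableOn (fun y : ℝ => y ^ (Module.finrank ℝ E - 1) *
      (y ^ s * Real.exp (-(y ^ 2 / (4 * Real.pi))))) (Ioi 0) := by
    refine (integrableOn_rpow_mul_exp_neg_mul_sq (b := (4 * Real.pi)⁻¹) (by positivity)
      (show -1 < (Module.finrank ℝ E - 1 : ℝ) + s by linarith)).congr_fun (fun y hy => ?_)
      measurableSet_Ioi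
    simp only [← mul_assoc, pow_sub_one_mul_rpow hy Module.finrank_pos, neg_mul, inv_mul_eq_div]
  have hfin := (lintegral_ofReal_fun_norm μ (fun y hy => by positivity) hint).trans_lt
    ENNReal.ofReal_lt_top
  simpa only [ENNReal.ofReal_mul (Real.rpow_nonneg (norm_nonneg _) s)] using hfin

lemma lintegral_rpow_neg_finrank_Icc {N : ℝ} (hN : 1 ≤ N) :
    ∫⁻ x, ENNReal.ofReal
        ((Icc 1 N).indicator (fun y : ℝ => y ^ (-(Module.finrank ℝ E : ℝ))) ‖x‖) ∂μ =
      ENNReal.ofReal (Module.finrank ℝ E * μ.real (Metric.ball 0 1) * Real.log N) := by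
  have hradial : ∀ y ∈ Ioi (0 : ℝ), (Icc 1 N).indicator (fun y => y⁻¹) y =
      y ^ (Module.finrank ℝ E - 1) *
        (Icc 1 N).indicator (fun y : ℝ => y ^ (-(Module.finrank ℝ E : ℝ))) y := fun y _ => by
    rw [← indicator_mul_right (Icc 1 N) fun z : ℝ => z ^ (Module.finrank ℝ E - 1)]
    refine congrFun (indicator_congr fun z hz => ?_) y
    rw [pow_sub_one_mul_rpow (one_pos.trans_le hz.1) Module.finrank_pos, sub_add_eq_add_sub,
      add_neg_cancel, zero_sub, Real.rpow_neg_one]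
  have hsub : Icc 1 N ⊆ Ioi 0 := fun y hy => one_pos.trans_le hy.1
  have h0 : (0 : ℝ) ∉ uIcc 1 N := fun h =>
    lt_irrefl (0 : ℝ) (hsub (uIcc_of_le hN ▸ h))
  have hinv : IntegrableOn (fun y : ℝ => y⁻¹) (Icc 1 N) :=
    (intervalIntegrable_iff_integrableOn_Icc_of_le hN).mp (intervalIntegrable_inv_iff.mpr (.inr h0))
  rw [lintegral_ofReal_fun_norm μ
    (fun y _ => indicator_nonneg (fun z hz => Real.rpow_nonneg (hsub hz).le _) y)
    ((hinv.integrable_indicator measurableSet_Icc).integrableOn.congr_fun hradial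
      measurableSet_Ioi),
    ← setIntegral_congr_fun measurableSet_Ioi hradial, setIntegral_indicator measurableSet_Icc,
    inter_eq_right.mpr hsub, integral_Icc_eq_integral_Ioc, ← intervalIntegral.integral_of_le hN,
    integral_inv h0, div_one]

lemma exists_lintegral_rpow_neg_finrank_mul_gaussian_le :
    ∃ C : ℝ≥0, ∀ R : ℝ, 0 < R → ∫⁻ x in (Metric.ball (0 : E) 1)ᶜ,
        ENNReal.ofReal (‖x‖ ^ (-(Module.finrank ℝ E : ℝ))) *
          ENNReal.ofReal (Real.exp (-(R ^ 2 * ‖x‖ ^ 2 / (4 * Real.pi)))) ∂μ ≤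
      C * ENNReal.ofReal (1 + Real.posLog R⁻¹) := by
  let v : ℝ := Module.finrank ℝ E * μ.real (Metric.ball 0 1)
  have hv : 0 ≤ v := by positivity
  obtain ⟨I, hI⟩ := WithTop.ne_top_iff_exists.mp (lintegral_rpow_mul_gaussian_lt_top μ
    (show -(Module.finrank ℝ E : ℝ) < 1 - Module.finrank ℝ E by linarith)).ne
  refine ⟨v.toNNReal + I, fun R hR => ?_⟩
  have hlog : Real.log (max 1 R⁻¹) = Real.posLog R⁻¹ :=
    (Real.posLog_eq_log_max_one (by positivity)).symm
  have hmeas : Measurable fun x : E => ENNReal.ofReal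
      ((Icc 1 (max 1 R⁻¹)).indicator (fun y : ℝ => y ^ (-(Module.finrank ℝ E : ℝ))) ‖x‖) :=
    (((measurable_id.pow_const _).indicator measurableSet_Icc).comp measurable_norm).ennreal_ofReal
  calc _ ≤ _ := setLIntegral_mono' measurableSet_ball.compl fun x hx =>
        rpow_neg_mul_gaussian_le (by simpa using hx) hR _
    _ ≤ _ := setLIntegral_le_lintegral _ _
    _ = ENNReal.ofReal (v * Real.posLog R⁻¹) + I := by
        rw [lintegral_add_left hmeas, lintegral_rpow_neg_finrank_Icc μ (le_max_left _ _), hlog,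
          lintegral_const_mul' _ _ ENNReal.ofReal_ne_top,
          lintegral_rpow_mul_gaussian_comp_smul μ hR, ← mul_assoc, ← ENNReal.ofReal_mul hR.le,
          neg_sub, sub_sub_cancel_left, Real.rpow_neg_one, mul_inv_cancel₀ hR.ne',
          ENNReal.ofReal_one, one_mul, ← hI]
        rfl
    _ ≤ _ := by
        have hlog0 := Real.posLog_nonneg (x := R⁻¹)
        rw [ENNReal.coe_add, add_mul, ENNReal.ofReal_mul hv]
        refine add_le_add (mul_le_mul_right (ENNReal.ofReal_le_ofReal (by linarith)) _)
          (le_mul_of_one_le_right zero_le ?_)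
        exact ENNReal.one_le_ofReal.mpr (by linarith)

end Radial

/-! ### Bounds for the quadratic form -/

section FormBounds

variable {n : ℕ} {θ α ω : ℝ} {h : Rn n → ℝ≥0∞}

lemma lintegral_lintegral_mul_comp_add (hm : AEMeasurable h) {w : Rn n → ℝ≥0∞}
    (hw : Measurable w) :
    ∫⁻ ξ, ∫⁻ η, h ξ * h η * w (ξ + η) = ∫⁻ ζ, selfConv h ζ * w ζ := by
  have hmeas : AEMeasurable (Function.uncurry fun η ζ => h (ζ - η) * h η * w ζ)
      (volume.prod volume) := by
    refine ((hm.comp_quasiMeasurePreserving ?_).mul hm.comp_fst).mul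
      (hw.comp measurable_snd).aemeasurable
    exact (quasiMeasurePreserving_sub_of_right_invariant volume volume).comp
      Measure.measurePreserving_swap.quasiMeasurePreserving
  have hconv_meas : ∀ ζ, AEMeasurable fun η => h (ζ - η) * h η := fun ζ =>
    (hm.comp_quasiMeasurePreserving
      (quasiMeasurePreserving_sub_left volume ζ)).mul hm
  calc _ = ∫⁻ η, ∫⁻ ζ, h (ζ - η) * h η * w ζ := by
        refine lintegral_congr fun ξ => ?_
        rw [← lintegral_sub_right_eq_self _ ξ]
        simp only [add_sub_cancel, mul_comm (h ξ)]
    _ = ∫⁻ ζ, ∫⁻ η, h (ζ - η) * h η * w ζ := lintegral_lintegral_swap hmeas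
    _ = _ := by
        refine lintegral_congr fun ζ => ?_
        rw [lintegral_mul_const'' _ (hconv_meas ζ), selfConv]

lemma gaussForm_le_mul_lintegral_selfConv (hm : AEMeasurable h) {K : ℝ≥0}
    (hK : ∀ᵐ ξ, h (-ξ) ≤ K * h ξ) (R : ℝ) :
    gaussForm h R ≤ K * ∫⁻ ζ, selfConv h ζ *
      ENNReal.ofReal (Real.exp (-(R ^ 2 * ‖ζ‖ ^ 2 / (4 * Real.pi)))) := by
  rw [← lintegral_lintegral_mul_comp_add hm (by fun_prop),
    ← lintegral_const_mul' _ _ ENNReal.coe_ne_top]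
  refine lintegral_mono fun ξ => ?_
  rw [← lintegral_const_mul' _ _ ENNReal.coe_ne_top, ← lintegral_neg_eq_self]
  refine lintegral_mono_ae ?_
  filter_upwards [hK] with η hη
  rw [sub_neg_eq_add, ← mul_assoc, mul_left_comm]
  gcongr

/-- Reflection turns the difference `ξ - η` in `gaussForm` into a sum; the convolution inequality
then leaves a single integral. -/
lemma IsRadialMajorizingKernel.exists_gaussForm_le_lintegral
    (hh : IsRadialMajorizingKernel θ α ω h) (hn : 0 < n) :
    ∃ C : ℝ≥0, ∀ R : ℝ, gaussForm h R ≤ C * ∫⁻ ζ, ENNReal.ofReal (‖ζ‖ ^ θ) * h ζ *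
      ENNReal.ofReal (Real.exp (-(R ^ 2 * ‖ζ‖ ^ 2 / (4 * Real.pi)))) := by
  obtain ⟨K, hK⟩ := hh.exists_neg_le_mul hn
  obtain ⟨B, hB, hconv⟩ := hh.conv_le
  refine ⟨K * B.toNNReal, fun R => ?_⟩
  have : Nonempty (Fin n) := ⟨⟨0, hn⟩⟩
  refine (gaussForm_le_mul_lintegral_selfConv hh.aemeasurable
    ((Measure.ae_ne volume 0).mono hK) R).trans ?_
  rw [ENNReal.coe_mul, mul_assoc, ← lintegral_const_mul' _ _ (ENNReal.coe_ne_top (r := B.toNNReal))]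
  refine mul_le_mul_right (lintegral_mono_ae ?_) _
  filter_upwards [hh.ae_ne_top] with ζ hζ
  have hζ_conv := hconv ζ hζ
  rw [ENNReal.ofReal_mul hB.le, mul_assoc] at hζ_conv
  rw [← mul_assoc]
  exact mul_le_mul_left hζ_conv _

lemma IsRadialMajorizingKernel.exists_gaussForm_le_rpow (hh : IsRadialMajorizingKernel θ α ω h)
    (hn : 0 < n) (hθ : 0 < θ) :
    ∃ C : ℝ≥0, ∀ R : ℝ, 0 < R → gaussForm h R ≤ C * ENNReal.ofReal (R ^ (-θ)) ^ 2 := by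
  have : Nonempty (Fin n) := ⟨⟨0, hn⟩⟩
  obtain ⟨C₁, hform⟩ := hh.exists_gaussForm_le_lintegral hn
  obtain ⟨C₂, hgrowth⟩ := hh.exists_le_mul_rpow hn
  obtain ⟨I, hI⟩ := WithTop.ne_top_iff_exists.mp (lintegral_rpow_mul_gaussian_lt_top
    (volume : Measure (Rn n)) (s := 2 * θ - n) (by rw [finrank_euclideanSpace_fin]; linarith)).ne
  refine ⟨C₁ * (C₂ * I), fun R hR => (hform R).trans ?_⟩
  rw [ENNReal.coe_mul, mul_assoc]
  refine mul_le_mul_right ?_ _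
  calc _ ≤ ∫⁻ ζ : Rn n, C₂ * (ENNReal.ofReal (‖ζ‖ ^ (2 * θ - n)) *
          ENNReal.ofReal (Real.exp (-(R ^ 2 * ‖ζ‖ ^ 2 / (4 * Real.pi))))) := by
        refine lintegral_mono_ae ((Measure.ae_ne volume 0).mono fun ζ hζ => ?_)
        rw [← mul_assoc, two_mul, add_sub_assoc, Real.rpow_add (norm_pos_iff.mpr hζ),
          ENNReal.ofReal_mul (by positivity), mul_left_comm]
        exact mul_le_mul_left (mul_le_mul_right (hgrowth ζ hζ) _) _
    _ = C₂ * (ENNReal.ofReal (R ^ (-(2 * θ - n) - n)) * I) := by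
        rw [lintegral_const_mul' _ _ ENNReal.coe_ne_top, lintegral_rpow_mul_gaussian_comp_smul _ hR,
          finrank_euclideanSpace_fin, ← hI]
        rfl
    _ = _ := by
        rw [← ENNReal.ofReal_pow (by positivity), ← Real.rpow_mul_natCast hR.le, ENNReal.coe_mul,
          mul_assoc, mul_comm (I : ℝ≥0∞)]
        congr 4
        push_cast
        ring

lemma IsRadialMajorizingKernel.lintegral_lt_top (hh : IsRadialMajorizingKernel θ α ω h)
    (hω : n < ω) : ∫⁻ ξ, h ξ < ∞ := by
  obtain ⟨c, -, C, hC, ρ, hρ, hbd⟩ := hh.at_infinity.exists_bounds_near_infinity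
  rw [← lintegral_add_compl h (measurableSet_ball (x := (0 : Rn n)) (ε := ρ))]
  refine ENNReal.add_lt_top.mpr ⟨hh.lintegral_ball_lt_top ρ, ?_⟩
  calc _ ≤ ∫⁻ ξ in (Metric.ball (0 : Rn n) ρ)ᶜ,
          ENNReal.ofReal C * ENNReal.ofReal (‖ξ‖ ^ (-ω)) := by
        refine setLIntegral_mono' measurableSet_ball.compl fun ξ hξ => ?_
        rw [← ENNReal.ofReal_mul hC.le]
        exact (hbd ξ (by simpa using hξ)).2
    _ ≤ ∫⁻ ξ in (Metric.ball (0 : Rn n) 1)ᶜ, ENNReal.ofReal C * ENNReal.ofReal (‖ξ‖ ^ (-ω)) :=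
        lintegral_mono_set (compl_subset_compl.mpr (Metric.ball_subset_ball hρ))
    _ = ENNReal.ofReal C * ∫⁻ ξ in (Metric.ball (0 : Rn n) 1)ᶜ, ENNReal.ofReal (‖ξ‖ ^ (-ω)) :=
        lintegral_const_mul' _ _ ENNReal.ofReal_ne_top
    _ < ∞ := ENNReal.mul_lt_top ENNReal.ofReal_lt_top
        (lintegral_rpow_neg_compl_ball_lt_top volume (by rwa [finrank_euclideanSpace_fin]))

lemma IsRadialMajorizingKernel.exists_gaussForm_le (hh : IsRadialMajorizingKernel 0 α ω h)
    (hn : 0 < n) (hω : n < ω) : ∃ C : ℝ≥0, ∀ R : ℝ, gaussForm h R ≤ C := by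
  obtain ⟨C, hform⟩ := hh.exists_gaussForm_le_lintegral hn
  obtain ⟨I, hI⟩ := WithTop.ne_top_iff_exists.mp (hh.lintegral_lt_top hω).ne
  refine ⟨C * I, fun R => (hform R).trans ?_⟩
  rw [ENNReal.coe_mul]
  refine mul_le_mul_right (le_of_le_of_eq (lintegral_mono fun ζ => ?_) hI.symm) _
  rw [Real.rpow_zero, ENNReal.ofReal_one, one_mul]
  exact mul_le_of_le_one_right' (ofReal_exp_neg_le_one (by positivity))

lemma IsRadialMajorizingKernel.exists_gaussForm_le_posLog (hh : IsRadialMajorizingKernel 0 α n h)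
    (hn : 0 < n) :
    ∃ C : ℝ≥0, ∀ R : ℝ, 0 < R → gaussForm h R ≤ C * ENNReal.ofReal (1 + Real.posLog R⁻¹) := by
  have : Nonempty (Fin n) := ⟨⟨0, hn⟩⟩
  obtain ⟨C₁, hform⟩ := hh.exists_gaussForm_le_lintegral hn
  obtain ⟨c, -, C₂, hC₂, ρ, hρ, hbd⟩ := hh.at_infinity.exists_bounds_near_infinity
  obtain ⟨C₃, hlog⟩ := exists_lintegral_rpow_neg_finrank_mul_gaussian_le (volume : Measure (Rn n))
  rw [finrank_euclideanSpace_fin] at hlog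
  obtain ⟨I, hI⟩ := WithTop.ne_top_iff_exists.mp (hh.lintegral_ball_lt_top ρ).ne
  refine ⟨C₁ * (I + C₂.toNNReal * C₃), fun R hR => (hform R).trans ?_⟩
  simp only [Real.rpow_zero, ENNReal.ofReal_one, one_mul]
  have hone : 1 ≤ ENNReal.ofReal (1 + Real.posLog R⁻¹) :=
    ENNReal.one_le_ofReal.mpr (le_add_of_nonneg_right Real.posLog_nonneg)
  rw [ENNReal.coe_mul, mul_assoc]
  refine mul_le_mul_right ?_ _
  rw [← lintegral_add_compl _ (measurableSet_ball (x := (0 : Rn n)) (ε := ρ)), ENNReal.coe_add,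
    add_mul]
  refine add_le_add ?_ ?_
  · refine (le_of_le_of_eq (lintegral_mono fun ξ => ?_) hI.symm).trans
      (le_mul_of_one_le_right zero_le hone)
    exact mul_le_of_le_one_right' (ofReal_exp_neg_le_one (by positivity))
  · rw [ENNReal.coe_mul, mul_assoc]
    refine le_trans ?_ (mul_le_mul_right (hlog R hR) _)
    rw [← lintegral_const_mul' _ _ ENNReal.coe_ne_top]
    refine (setLIntegral_mono' measurableSet_ball.compl fun ξ hξ => ?_).trans
      (lintegral_mono_set (compl_subset_compl.mpr (Metric.ball_subset_ball hρ)))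
    rw [← mul_assoc, ← ENNReal.ofReal, ← ENNReal.ofReal_mul hC₂.le]
    exact mul_le_mul_left (hbd ξ (by simpa using hξ)).2 _

end FormBounds

/-! ### The rate functions -/

lemma sq_mul_one_add_posLog_inv_le {R S : ℝ} (hR : 0 < R) (hRS : R ≤ S) :
    R ^ 2 * (1 + Real.posLog R⁻¹) ≤ S ^ 2 * (1 + Real.posLog S⁻¹) := by
  have hS : 0 < S := hR.trans_le hRS
  have hposLog_nonneg : 0 ≤ Real.posLog S⁻¹ := Real.posLog_nonneg
  have hposLog : Real.posLog R⁻¹ ≤ Real.posLog S⁻¹ + (S / R - 1) := by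
    have hratio : 1 ≤ S / R := (one_le_div₀ hR).mpr hRS
    calc Real.posLog R⁻¹ = Real.posLog (S⁻¹ * (S / R)) := by
          congr 1
          field_simp
      _ ≤ Real.posLog S⁻¹ + Real.posLog (S / R) := Real.posLog_mul
      _ ≤ _ := by
          rw [Real.posLog_eq_log (hratio.trans (le_abs_self _))]
          gcongr
          exact Real.log_le_sub_one_of_pos (by positivity)
  calc R ^ 2 * (1 + Real.posLog R⁻¹) ≤ R ^ 2 * (Real.posLog S⁻¹ + S / R) := by
        refine mul_le_mul_of_nonneg_left ?_ (sq_nonneg R)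
        linarith
    _ = R ^ 2 * Real.posLog S⁻¹ + R * S := by field_simp
    _ ≤ S ^ 2 * Real.posLog S⁻¹ + S * S := by gcongr
    _ = _ := by ring

lemma sq_rpow_half_mul_posLog {T : ℝ} (hT : 0 ≤ T) :
    (T ^ (1 / 2 : ℝ) * (1 + Real.posLog (T ^ (-1 / 2 : ℝ))) ^ (1 / 2 : ℝ)) ^ 2 =
      √T ^ 2 * (1 + Real.posLog (√T)⁻¹) := by
  have hposLog : 0 ≤ Real.posLog (T ^ (-1 / 2 : ℝ)) := Real.posLog_nonneg
  rw [mul_pow, ← Real.sqrt_eq_rpow, ← Real.sqrt_eq_rpow,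
    Real.sq_sqrt (x := 1 + Real.posLog _) (by positivity), neg_div, Real.rpow_neg hT,
    ← Real.sqrt_eq_rpow]

lemma tendsto_rpow_half_mul_posLog :
    Tendsto (fun T : ℝ => T ^ (1 / 2 : ℝ) * (1 + Real.posLog (T ^ (-1 / 2 : ℝ))) ^ (1 / 2 : ℝ))
      (𝓝[>] 0) (𝓝 0) := by
  have hsqrt : Tendsto (fun T : ℝ => √(T + √T)) (𝓝[>] 0) (𝓝 0) := by
    have hcont : Continuous fun T : ℝ => √(T + √T) := by fun_prop
    simpa using (hcont.tendsto 0).mono_left nhdsWithin_le_nhds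
  refine tendsto_of_tendsto_of_tendsto_of_le_of_le' tendsto_const_nhds hsqrt ?_ ?_ <;>
    filter_upwards [self_mem_nhdsWithin] with T (hT : 0 < T)
  · have hposLog : 0 ≤ Real.posLog (T ^ (-1 / 2 : ℝ)) := Real.posLog_nonneg
    positivity
  · refine Real.le_sqrt_of_sq_le ?_
    have hposLog : Real.posLog (√T)⁻¹ ≤ (√T)⁻¹ := by
      rw [Real.posLog_apply]
      exact max_le (by positivity) (Real.log_le_self (by positivity))
    calc _ = √T ^ 2 * (1 + Real.posLog (√T)⁻¹) := sq_rpow_half_mul_posLog hT.le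
      _ ≤ √T ^ 2 * (1 + (√T)⁻¹) := by gcongr
      _ = √T ^ 2 + √T := by field_simp
      _ = T + √T := by rw [Real.sq_sqrt hT.le]

lemma tendsto_rpow_nhdsGT_zero {s : ℝ} (hs : 0 < s) :
    Tendsto (fun T : ℝ => T ^ s) (𝓝[>] 0) (𝓝 0) := by
  simpa [Real.zero_rpow hs.ne'] using
    ((Real.continuous_rpow_const hs.le).tendsto 0).mono_left nhdsWithin_le_nhds

/-! ### The `BMO⁻¹` bounds -/

section Bounds

variable {n : ℕ} {F : Type*} [NormedAddCommGroup F] [InnerProductSpace ℂ F] [CompleteSpace F]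
  {θ α ω : ℝ} {h : Rn n → ℝ≥0∞}

lemma IsRadialMajorizingKernel.exists_bmoNorm_le (hh : IsRadialMajorizingKernel θ α ω h)
    {φ : ℝ → ℝ} {D : ℝ≥0} (hD : ∀ T R, 0 < R → R ^ 2 < T →
      ENNReal.ofReal (R ^ 2) * gaussForm h R ≤ D * ENNReal.ofReal (φ T) ^ 2) :
    ∃ C : ℝ≥0, ∀ f ∈ majSpace F h, ∀ T : ℝ, 0 < T →
      bmoNorm T f ≤ C * ENNReal.ofReal (φ T) * majNorm h f := by
  obtain ⟨K, hK⟩ := hh.exists_le_of_le_norm one_pos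
  obtain ⟨C, hC⟩ := exists_bmoNorm_le_mul_majNorm (F := F) hh.pos hh.finite_ae hK hD
  exact ⟨C, fun f hf T _ => hC f hf T⟩

theorem IsRadialMajorizingKernel.exists_bmoNorm_le_rpow (hh : IsRadialMajorizingKernel θ α ω h)
    (hn : 0 < n) (hθ : 0 < θ) (hθ1 : θ ≤ 1) :
    ∃ C : ℝ≥0, ∀ f ∈ majSpace F h, ∀ T : ℝ, 0 < T →
      bmoNorm T f ≤ C * ENNReal.ofReal (T ^ ((1 - θ) / 2)) * majNorm h f := by
  obtain ⟨D, hD⟩ := hh.exists_gaussForm_le_rpow hn hθ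
  refine hh.exists_bmoNorm_le (D := D) fun T R hR hRT => ?_
  have hrpow : R ^ (1 - θ) ≤ T ^ ((1 - θ) / 2) := by
    calc R ^ (1 - θ) = (R ^ 2) ^ ((1 - θ) / 2) := by
          rw [← Real.rpow_natCast_mul hR.le]
          congr 1
          push_cast
          ring
      _ ≤ _ := Real.rpow_le_rpow (by positivity) hRT.le (by linarith)
  calc _ ≤ ENNReal.ofReal (R ^ 2) * (D * ENNReal.ofReal (R ^ (-θ)) ^ 2) :=
        mul_le_mul_right (hD R hR) _
    _ = D * ENNReal.ofReal (R ^ (1 - θ)) ^ 2 := by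
        rw [sub_eq_add_neg, Real.rpow_add hR, Real.rpow_one, ENNReal.ofReal_mul hR.le,
          ENNReal.ofReal_pow hR.le]
        ring
    _ ≤ _ := by gcongr

theorem IsRadialMajorizingKernel.exists_bmoNorm_le_sqrt (hh : IsRadialMajorizingKernel 0 α ω h)
    (hn : 0 < n) (hω : n < ω) :
    ∃ C : ℝ≥0, ∀ f ∈ majSpace F h, ∀ T : ℝ, 0 < T →
      bmoNorm T f ≤ C * ENNReal.ofReal (T ^ (1 / 2 : ℝ)) * majNorm h f := by
  obtain ⟨D, hD⟩ := hh.exists_gaussForm_le hn hω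
  refine hh.exists_bmoNorm_le (D := D) fun T R _ hRT => ?_
  rw [← ENNReal.ofReal_pow (by have := (sq_nonneg R).trans hRT.le; positivity),
    ← Real.sqrt_eq_rpow, Real.sq_sqrt ((sq_nonneg R).trans hRT.le), mul_comm]
  exact mul_le_mul' (hD R) (ENNReal.ofReal_le_ofReal hRT.le)

theorem IsRadialMajorizingKernel.exists_bmoNorm_le_log (hh : IsRadialMajorizingKernel 0 α n h)
    (hn : 0 < n) :
    ∃ C : ℝ≥0, ∀ f ∈ majSpace F h, ∀ T : ℝ, 0 < T →
      bmoNorm T f ≤ C * ENNReal.ofReal (T ^ (1 / 2 : ℝ) *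
        (1 + Real.posLog (T ^ (-1 / 2 : ℝ))) ^ (1 / 2 : ℝ)) * majNorm h f := by
  obtain ⟨D, hD⟩ := hh.exists_gaussForm_le_posLog hn
  refine hh.exists_bmoNorm_le (D := D) fun T R hR hRT => ?_
  have hT : 0 ≤ T := (sq_nonneg R).trans hRT.le
  have hposLog : 0 ≤ Real.posLog (T ^ (-1 / 2 : ℝ)) := Real.posLog_nonneg
  rw [← ENNReal.ofReal_pow (by positivity), sq_rpow_half_mul_posLog hT]
  calc _ ≤ ENNReal.ofReal (R ^ 2) * (D * ENNReal.ofReal (1 + Real.posLog R⁻¹)) :=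
        mul_le_mul_right (hD R hR) _
    _ = D * ENNReal.ofReal (R ^ 2 * (1 + Real.posLog R⁻¹)) := by
        rw [ENNReal.ofReal_mul (by positivity), mul_left_comm]
    _ ≤ _ := mul_le_mul_right (ENNReal.ofReal_le_ofReal
        (sq_mul_one_add_posLog_inv_le hR (Real.le_sqrt_of_sq_le hRT.le))) _

end Bounds

end MajorizingKernels

end

theorem mainTheorem5_general {n : ℕ} {F : Type*} [NormedAddCommGroup F] [InnerProductSpace ℂ F]
    [CompleteSpace F] (hn : 0 < n) {θ α ω : ℝ} {h : Rn n → ℝ≥0∞}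
    (hh : IsRadialMajorizingKernel θ α ω h) :
    (0 < θ → θ < 1 →
      (∃ C : ℝ≥0, ∀ f ∈ majSpace F h, ∀ T : ℝ, 0 < T →
        bmoNorm T f ≤ C * ENNReal.ofReal (T ^ ((1 - θ) / 2)) * majNorm h f) ∧
      ContinuouslyEmbeds (majSpace F h) (majNorm h) (vmoSpace n F) (bmoNorm 1)) ∧
    (θ = 0 →
      (n < ω →
        ∃ C : ℝ≥0, ∀ f ∈ majSpace F h, ∀ T : ℝ, 0 < T →
          bmoNorm T f ≤ C * ENNReal.ofReal (T ^ (1 / 2 : ℝ)) * majNorm h f) ∧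
      (ω = n →
        ∃ C : ℝ≥0, ∀ f ∈ majSpace F h, ∀ T : ℝ, 0 < T →
          bmoNorm T f ≤ C * ENNReal.ofReal (T ^ (1 / 2 : ℝ) *
            (1 + Real.posLog (T ^ (-1 / 2 : ℝ))) ^ (1 / 2 : ℝ)) * majNorm h f) ∧
      ContinuouslyEmbeds (majSpace F h) (majNorm h) (vmoSpace n F) (bmoNorm 1)) := by
  refine ⟨fun hθ hθ1 => ?_, ?_⟩
  · have hrpow := hh.exists_bmoNorm_le_rpow (F := F) hn hθ hθ1.le
    exact ⟨hrpow, continuouslyEmbeds_vmoSpace (tendsto_rpow_nhdsGT_zero (by linarith)) hrpow⟩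
  · rintro rfl
    refine ⟨hh.exists_bmoNorm_le_sqrt hn, ?_, ?_⟩
    · rintro rfl
      exact hh.exists_bmoNorm_le_log hn
    · have hω : (n : ℝ) ≤ ω := by simpa using hh.le_omega hn
      rcases hω.lt_or_eq with hlt | rfl
      · exact continuouslyEmbeds_vmoSpace (tendsto_rpow_nhdsGT_zero one_half_pos)
          (hh.exists_bmoNorm_le_sqrt hn hlt)
      · exact continuouslyEmbeds_vmoSpace tendsto_rpow_half_mul_posLog
          (hh.exists_bmoNorm_le_log hn)

theorem mainTheorem5 {n m : ℕ} (hn : 2 ≤ n) {θ α ω : ℝ} (h : Rn n → ℝ≥0∞)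
    (hh : IsRadialMajorizingKernel θ α ω h) :
    (0 < θ → θ < 1 →
      (∃ C : ℝ≥0, ∀ f ∈ majSpace (EuclideanSpace ℂ (Fin m)) h, ∀ T : ℝ, 0 < T →
        bmoNorm T f ≤ C * ENNReal.ofReal (T ^ ((1 - θ) / 2)) * majNorm h f) ∧
      ContinuouslyEmbeds (majSpace (EuclideanSpace ℂ (Fin m)) h) (majNorm h)
        (vmoSpace n (EuclideanSpace ℂ (Fin m))) (bmoNorm 1)) ∧
    (θ = 0 →
      (n < ω →
        ∃ C : ℝ≥0, ∀ f ∈ majSpace (EuclideanSpace ℂ (Fin m)) h, ∀ T : ℝ, 0 < T →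
          bmoNorm T f ≤ C * ENNReal.ofReal (T ^ (1 / 2 : ℝ)) * majNorm h f) ∧
      (ω = n →
        ∃ C : ℝ≥0, ∀ f ∈ majSpace (EuclideanSpace ℂ (Fin m)) h, ∀ T : ℝ, 0 < T →
          bmoNorm T f ≤ C * ENNReal.ofReal (T ^ (1 / 2 : ℝ) *
            (1 + Real.posLog (T ^ (-1 / 2 : ℝ))) ^ (1 / 2 : ℝ)) * majNorm h f) ∧
      ContinuouslyEmbeds (majSpace (EuclideanSpace ℂ (Fin m)) h) (majNorm h)
        (vmoSpace n (EuclideanSpace ℂ (Fin m))) (bmoNorm 1)) :=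
  mainTheorem5_general (by omega) hh
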